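/- **Setting.** Fix a distinguished type $t$, whose instantiations are the non-empty finite sets $T=\{0,\dots,\#T-1\}$. An event is $c.v_1\ldots v_k$, where the channel $c$ fixes $k$ and fixes which of the $v_i$ are of type $t$. *Process syntaxes* $P(t)$ are the sequential CSP terms $$P ::= STOP \mid \alpha\to P \mid P\,\Box\,P \mid P\sqcap P \mid P\rhd P \mid \mathrm{if}\ b\ \mathrm{then}\ P\ \mathrm{else}\ P \mid X,$$ with identifiers $X$ defined in a global environment. A construct is $\alpha=c\S_1x_1{:}X_1\ldots\S_kx_k{:}X_k$ with each $\S_i\in\{\$,?,!\}$ (nondeterministic selection, deterministic input, output). Process syntaxes are data independent in $t$: type $t$ occurs only in selections $\$x{:}t$ and $?x{:}t$ over all of $t$, in outputs $!x$ of variables, and in conditions built from equality tests of variables; a condition mentions only variables of type $t$ or only variables and values of other types. $\$^t(\alpha)$, $?^t(\alpha)$, $!^t(\alpha)$ denote the sets of positions of type $t$ with the respective symbol, and $?(\alpha)$ the set of all positions with $\S_i={?}$. $P(T)$ is the process (labelled transition system with internal event $\tau$) given by the standard operational semantics, in which all selections $\$$ of types other than $t$, and then all selections $\$x{:}t$, are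 resolved by $\tau$-steps before the event of a construct occurs. For processes $P,Q$: $P\sqsubseteq_F Q$ means $\mathrm{traces}(Q)\subseteq\mathrm{traces}(P)$ and $\mathrm{failures}(Q)\subseteq\mathrm{failures}(P)$, where $(tr,X)$ is a failure if after $tr$ a state can be reached that has no $\tau$-transition and no transition labelled in $X$. An implementation $Impl(t)$ is any family of processes $Impl(T)$, one for each $T$, and $\phi(Impl(T))$ is $Impl(T)$ with $\phi$ applied to all values of type $t$ in its events. *Conditions.* In these, "within" and "initial" (not after a prefix) are understood with identifiers unfolded. - **SeqNorm** ($P(t)$ is of the above form, and): in external and sliding choices, a variable of an initial selection $\$x{:}t$ of one argument is not free in the other argument; no construct contains an input variable of type $t$ more than once; and in every choice $A\,\Box\,B$, $A\sqcap B$, $A\rhd B$ within $P(t)$, the sets of channels of the initial constructs of $A$ and of $B$ are disjoint and every conditional on $t$ in $A$ and $B$ is after a prefix. - **RevPosConjEqT$_F$**: for every conditional "if $b$ then $P$ else $Q$" on $t$ within the process syntax, $b$ is a conjunction of equality tests, and $Q(v_1,\dots,v_k)\sqsubseteq_F P(v_1,\dots,v_k)$ for all $T$ and all values $v_1,\dots,v_k$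 of the free variables. - **TypeSym**: for every $T$ and every bijection $\pi:T\to T$, $Impl(T)$ is strongly bisimilar to $Impl(T)$ renamed by $\pi$. *Symbolic semantics.* In the semi-symbolic transition system of $P(t)$ variables of type $t$ stay symbolic and everything else is concrete. Its labels are $\tau$; visible symbolic events $\epsilon$, i.e. constructs in which every field not of type $t$ is the output of a value (deterministic inputs of other types give one transition for each value, and nondeterministic selections of other types are resolved first by a $\tau$); and conditions $b$ and $\neg b$, which lead a conditional on $t$ to its first and second branch and which, like $\tau$, do not resolve $\Box$ and $\rhd$. A symbolic trace is the sequence of labels of a finite path from $P(t)$. Two symbolic traces are non-$t$ equivalent if their visible symbolic events agree, one by one, on the channel and on all fields not of type $t$. For $\sigma\frown\langle\epsilon\rangle$ a symbolic trace of $P(t)$, let $!^t(\sigma,\epsilon)(P(t))$ be the union of the $!^t(\epsilon')$ over all symbolic traces $\sigma'\frown\langle\epsilon'\rangle$ of $P(t)$ that are non-$t$ equivalent to $\sigma\frown\langle\epsilon\rangle$. For a symbolic trace $\sigma$ of $P(t)$ and a partial function $\Gamma$ from variables of type $t$ to $T$, let $A(\sigma,\Gamma)$ be the set of all visible $\epsilon$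 for which some path of $P(t)$ has the labels $\sigma\frown\rho\frown\langle\epsilon\rangle$, with $\rho$ consisting of $\tau$'s and of conditions that are (defined and) true in $\Gamma$. **Theorem (extendibility of stable failures refinement).** Let $B\ge 0$ be an integer and suppose that 1. $Spec(t)$ is a process syntax without free variables other than $t$ that satisfies **SeqNorm** and **RevPosConjEqT**$_F$, and for every $T$ the process $Spec(T)$ is divergence-free and has a finite alphabet (only finitely many events occur in its traces); 2. $Impl(t)$ satisfies **TypeSym**; 3. no construct $\alpha$ in $Spec(t)$ combines nondeterministic selections of type $t$ with deterministic inputs of any type: if $\#\$^t(\alpha)>0$ then $\#?(\alpha)=0$; 4. $T$ is an instantiation of $t$ with $\#T\ge B+1$; 5. $B\ge Thresh$, where $Thresh$ is the maximum of $$Thresh_T=\max\{\#\,!^t(\sigma,\epsilon)(Spec(t)) : \sigma\frown\langle\epsilon\rangle\text{ a symbolic trace of }Spec(t)\}$$ and of $$\max\{Thresh_{!^t}(\sigma,\Gamma)+Thresh_{?^t}(\sigma,\Gamma)\},$$ taken over all symbolic traces $\sigma$ of $Spec(t)$ that are empty or end in a visible symbolic event and all partial functions $\Gamma$ from variables of type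 $t$ to $T$. Here $Thresh_{!^t}(\sigma,\Gamma)$ is the number of distinct variables that are outputs of type $t$ of some $\epsilon\in A(\sigma,\Gamma)$, and $Thresh_{?^t}(\sigma,\Gamma)=\sum_{\epsilon\in A(\sigma,\Gamma)}\#?^t(\epsilon)$ (in particular these maxima exist); 6. $\phi:T\to\{0,\dots,B\}$ is the $B$-collapsing function: $\phi(v)=v$ for $v<B$ and $\phi(v)=B$ for $v\ge B$. If $Spec(\phi(T))\sqsubseteq_F\phi(Impl(T))$, then $Spec(T)\sqsubseteq_F Impl(T)$. -/

import Mathlib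

/-! ## Labelled transition systems, traces, stable failures -/

universe u v w

namespace CSP

/-- A labelled transition system with labels in `L`. -/
structure LTS (L : Type u) where
  State : Type v
  start : State
  trans : State → L → State → Prop

/-- `Path tr p s q`: there is a path from `p` to `q` whose labels are, in order, `s`. -/
inductive Path {St : Type v} {L : Type u} (tr : St → L → St → Prop) : St → List L → St → Prop
  | nil (p : St) : Path tr p [] p
  | cons {p q r : St} {a : L} {s : List L} : tr p a q → Path tr q s r → Path tr p (a :: s) r

namespace LTS

variable {Ev : Type u}

/-- In the LTS of a process the label `none` is the internal event `τ` and `some e` is the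
visible event `e`.  `WeakPath M p t q`: from `p` the process can reach `q` performing exactly the
sequence `t` of visible events, with any internal events in between. -/
def WeakPath (M : LTS.{u, v} (Option Ev)) (p : M.State) (t : List Ev) (q : M.State) : Prop :=
  ∃ s : List (Option Ev), Path M.trans p s q ∧ s.reduceOption = t

/-- The state `q` is stable (no `τ` is available) and can perform no event of `X`. -/
def Refuses (M : LTS.{u, v} (Option Ev)) (q : M.State) (X : Set Ev) : Prop :=
  (∀ q', ¬ M.trans q none q') ∧ ∀ e ∈ X, ∀ q', ¬ M.trans q (some e) q'

def traces (M : LTS.{u, v} (Option Ev)) : Set (List Ev) :=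
  {t | ∃ q, M.WeakPath M.start t q}

def failures (M : LTS.{u, v} (Option Ev)) : Set (List Ev × Set Ev) :=
  {f | ∃ q, M.WeakPath M.start f.1 q ∧ M.Refuses q f.2}

/-- `Refined P Q` is `P ⊑_F Q`: the process `Q` refines `P` in the stable failures model. -/
def Refined (P : LTS.{u, v} (Option Ev)) (Q : LTS.{u, w} (Option Ev)) : Prop :=
  Q.traces ⊆ P.traces ∧ Q.failures ⊆ P.failures

/-- No reachable state is the start of an infinite sequence of internal events. -/
def DivergenceFree (M : LTS.{u, v} (Option Ev)) : Prop :=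
  ¬ ∃ (t : List Ev) (f : ℕ → M.State),
      M.WeakPath M.start t (f 0) ∧ ∀ i, M.trans (f i) none (f (i + 1))

/-- The set of the events that the process can ever perform. -/
def alphabet (M : LTS.{u, v} (Option Ev)) : Set Ev :=
  {e | ∃ t ∈ M.traces, e ∈ t}

/-- Functional renaming: every visible event `e` is renamed to `f e`. -/
def rename {Ev' : Type w} (M : LTS.{u, v} (Option Ev)) (f : Ev → Ev') : LTS.{w, v} (Option Ev') where
  State := M.State
  start := M.start
  trans p b q := ∃ a, M.trans p a q ∧ Option.map f a = b

/-- Strong bisimilarity. -/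
def Bisimilar {L : Type u} (M : LTS.{u, v} L) (N : LTS.{u, w} L) : Prop :=
  ∃ R : M.State → N.State → Prop, R M.start N.start ∧ ∀ p q, R p q →
    (∀ a p', M.trans p a p' → ∃ q', N.trans q a q' ∧ R p' q') ∧
    (∀ a q', N.trans q a q' → ∃ p', M.trans p a p' ∧ R p' q')

end LTS

/-! ## Events and process syntax -/

/-- The names from which events and terms are built.  A channel `c` passes `arity c` pieces of data;
position `i` carries values of the distinguished type `t` if `isT c i`, and otherwise
values in `Val` (the values of all the other types).  `Var` are the variables of type `t`, `Ident`
the process identifiers. -/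
structure Sig where
  Chan : Type u
  arity : Chan → ℕ
  isT : (c : Chan) → Fin (arity c) → Prop
  Val : Type u
  Var : Type u
  Ident : Type u

variable {S : Sig.{u}}

/-- The positions of type `t` of a channel. -/
abbrev TPos (S : Sig.{u}) (c : S.Chan) : Type := {i : Fin (S.arity c) // S.isT c i}

/-- The other positions of a channel. -/
abbrev NPos (S : Sig.{u}) (c : S.Chan) : Type := {i : Fin (S.arity c) // ¬ S.isT c i}

/-- A visible event `c.v₁…v_k`, for the instantiation `T` of the distinguished type; the values at
the positions of type `t` and at the other positions are listed separately. -/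
structure Event (S : Sig.{u}) (T : Type) where
  chan : S.Chan
  tval : TPos S chan → T
  nval : NPos S chan → S.Val

/-- A function on the values of type `t`, lifted to events. -/
def Event.map {T T' : Type} (f : T → T') (e : Event S T) : Event S T' :=
  ⟨e.chan, fun i => f (e.tval i), e.nval⟩

/-- A variable of type `t`, or a value that has been substituted for one. -/
abbrev Atom (S : Sig.{u}) (T : Type) : Type u := S.Var ⊕ T

/-- A field of type `t` of a prefix construct: `$x:t`, `?x:t` or `!a`. -/
inductive TField (S : Sig.{u}) (T : Type) : Type u
  | nd (x : S.Var)
  | inp (x : S.Var)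
  | out (a : Atom S T)

/-- A field not of type `t` of a prefix construct on channel `c`: `$x:X`, `?x:X` or `!v`.
Variables of these types are not named: what depends on them is a function of the tuple of the
values at the positions of `c`.  The value of an output is such a function, because it may mention
input variables of the same construct, as in `c?y:Y!y`. -/
inductive NField (S : Sig.{u}) (c : S.Chan) : Type u
  | nd (X : Set S.Val)
  | inp (X : Set S.Val)
  | out (f : (NPos S c → S.Val) → S.Val)

/-- Boolean conditions on `t`: built from equality tests. -/
inductive Guard (S : Sig.{u}) (T : Type) : Type u
  | eq (a b : Atom S T)
  | not (g : Guard S T)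
  | and (g h : Guard S T)
  | or (g h : Guard S T)

/-- Sequential terms `STOP`, `α → P`, `P □ Q`, `P ⊓ Q`, `P ▷ Q`, `if b then P else Q`, `X`, without
renaming, hiding and replicated choices.

`Term S Empty` is the type of process syntaxes.  They are data independent by
construction: type `t` occurs in them only through selections `$x:t` and `?x:t` over the whole of
`t`, outputs `!x` of variables and boolean combinations of equality tests of variables; there are no
constants of type `t`, no functions or operations on `t`, and nothing depends on the instantiation.
`Term S T` also has values in `T` that were substituted for variables.

The continuation of a prefix is a function of the values at the positions not of type `t`, which
stands for the substitution of these values for the input variables at these positions.  A condition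
not on `t` is thus already evaluated, to `b`.  An identifier `X` carries the values
substituted so far for the free variables of its definition. -/
inductive Term (S : Sig.{u}) (T : Type) : Type u
  | STOP
  | pre (c : S.Chan) (tf : TPos S c → TField S T) (nf : NPos S c → NField S c)
      (k : (NPos S c → S.Val) → Term S T)
  | ext (P Q : Term S T)
  | int (P Q : Term S T)
  | slide (P Q : Term S T)
  | ifN (b : Bool) (P Q : Term S T)
  | ifT (g : Guard S T) (P Q : Term S T)
  | call (X : S.Ident) (Γ : S.Var → Option T)

/-- Process syntaxes; all their variables stand for themselves. -/
abbrev Syn (S : Sig.{u}) : Type u := Term S Empty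

/-- Global environments: every identifier is mapped to its definition. -/
abbrev Defn (S : Sig.{u}) : Type u := S.Ident → Syn S

/-! ## Substitution -/

section Substitution

variable {T : Type}

def Atom.subst (Γ : S.Var → Option T) : Atom S T → Atom S T
  | .inl x => match Γ x with
    | some v => .inr v
    | none => .inl x
  | .inr v => .inr v

def TField.subst (Γ : S.Var → Option T) : TField S T → TField S T
  | .nd x => .nd x
  | .inp x => .inp x
  | .out a => .out (Atom.subst Γ a)

def Guard.subst (Γ : S.Var → Option T) : Guard S T → Guard S T
  | .eq a b => .eq (Atom.subst Γ a) (Atom.subst Γ b)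
  | .not g => .not (g.subst Γ)
  | .and g h => .and (g.subst Γ) (h.subst Γ)
  | .or g h => .or (g.subst Γ) (h.subst Γ)

/-- The variable `x` is bound by the fields `tf`. -/
def Binds {c : S.Chan} (tf : TPos S c → TField S T) (x : S.Var) : Prop :=
  ∃ i, tf i = .nd x ∨ tf i = .inp x

open Classical in
/-- `P[Γ(x)/x | x ∈ dom Γ]`: replaces the free occurrences of variables. -/
noncomputable def Term.subst : Term S T → (S.Var → Option T) → Term S T
  | .STOP, _ => .STOP
  | .pre c tf nf k, Γ => .pre c (fun i => (tf i).subst Γ) nf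
      (fun w => (k w).subst (fun x => if Binds tf x then none else Γ x))
  | .ext P Q, Γ => .ext (P.subst Γ) (Q.subst Γ)
  | .int P Q, Γ => .int (P.subst Γ) (Q.subst Γ)
  | .slide P Q, Γ => .slide (P.subst Γ) (Q.subst Γ)
  | .ifN b P Q, Γ => .ifN b (P.subst Γ) (Q.subst Γ)
  | .ifT g P Q, Γ => .ifT (g.subst Γ) (P.subst Γ) (Q.subst Γ)
  | .call X Δ, Γ => .call X (fun x => (Δ x).or (Γ x))

def Atom.embed : Atom S Empty → Atom S T := Sum.map id Empty.elim

def TField.embed : TField S Empty → TField S T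
  | .nd x => .nd x
  | .inp x => .inp x
  | .out a => .out (Atom.embed a)

def Guard.embed : Guard S Empty → Guard S T
  | .eq a b => .eq (Atom.embed a) (Atom.embed b)
  | .not g => .not g.embed
  | .and g h => .and g.embed h.embed
  | .or g h => .or g.embed h.embed

/-- The process syntax `P(t)` as a term over the instantiation `T` of `t`. -/
def Term.embed : Term S Empty → Term S T
  | .STOP => .STOP
  | .pre c tf nf k => .pre c (fun i => (tf i).embed) nf (fun w => (k w).embed)
  | .ext P Q => .ext P.embed Q.embed
  | .int P Q => .int P.embed Q.embed
  | .slide P Q => .slide P.embed Q.embed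
  | .ifN b P Q => .ifN b P.embed Q.embed
  | .ifT g P Q => .ifT g.embed P.embed Q.embed
  | .call X _ => .call X (fun _ => none)

/-- `P(T)[Γ(x)/x | x ∈ dom Γ]`. -/
noncomputable def Term.inst (P : Syn S) (Γ : S.Var → Option T) : Term S T := P.embed.subst Γ

/-- The condition contains no variables. -/
def Guard.Closed : Guard S T → Prop
  | .eq a b => (∃ v, a = .inr v) ∧ ∃ v, b = .inr v
  | .not g => g.Closed
  | .and g h => g.Closed ∧ h.Closed
  | .or g h => g.Closed ∧ h.Closed

/-- The truth value of a condition without variables. -/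
def Guard.Holds : Guard S T → Prop
  | .eq a b => a = b
  | .not g => ¬ g.Holds
  | .and g h => g.Holds ∧ h.Holds
  | .or g h => g.Holds ∨ h.Holds

end Substitution

/-! ## Standard operational semantics -/

section Semantics

variable {T : Type}

/-- Replaces each `$x:t` by `!x`. -/
def replaceT {c : S.Chan} (tf : TPos S c → TField S T) : TPos S c → TField S T := fun i =>
  match tf i with
  | .nd x => .out (.inl x)
  | .inp x => .inp x
  | .out a => .out a

open Classical in
/-- `{x_i ↦ v_i}`, where `i` ranges over the positions with field `b x_i`
(`b` is `TField.nd` or `TField.inp`). -/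
noncomputable def bindings {c : S.Chan} (b : S.Var → TField S T) (tf : TPos S c → TField S T)
    (v : TPos S c → T) : S.Var → Option T := fun x =>
  if h : ∃ i, tf i = b x then some (v h.choose) else none

/-- The tuple of values `w`, with the nondeterministic selections taken from `v`. -/
def chosen {c : S.Chan} (nf : NPos S c → NField S c) (v w : NPos S c → S.Val) : NPos S c → S.Val :=
  fun j => match nf j with
  | .nd _ => v j
  | _ => w j

/-- Replaces each `$x_i:X_i` (`X_i` not `t`) by `!x_i` and substitutes `v_i` for `x_i`. -/
def resolveN {c : S.Chan} (nf : NPos S c → NField S c) (v : NPos S c → S.Val) :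
    NPos S c → NField S c := fun j =>
  match nf j with
  | .nd _ => .out (fun _ => v j)
  | .inp X => .inp X
  | .out f => .out (fun w => f (chosen nf v w))

/-- There is a nondeterministic selection of type `t`. -/
def HasNdT {c : S.Chan} (tf : TPos S c → TField S T) : Prop := ∃ i x, tf i = .nd x

/-- There is a nondeterministic selection not of type `t`. -/
def HasNdN {c : S.Chan} (nf : NPos S c → NField S c) : Prop := ∃ j X, nf j = .nd X

/-- `w` takes values in the sets of the selections and the right values of the outputs. -/
def NAdmissible {c : S.Chan} (nf : NPos S c → NField S c) (w : NPos S c → S.Val) : Prop :=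
  ∀ j, match nf j with
  | .nd X => w j ∈ X
  | .inp X => w j ∈ X
  | .out f => w j = f w

/-- The positions of type `t` of an event agree with the inputs and outputs (and there are no
unresolved selections). -/
def TComms {c : S.Chan} (tf : TPos S c → TField S T) (v : TPos S c → T) : Prop :=
  ∀ i, match tf i with
  | .nd _ => False
  | .inp _ => True
  | .out a => a = .inr (v i)

/-- The transitions of the standard operational semantics. -/
inductive Step (E : Defn S) : Term S T → Option (Event S T) → Term S T → Prop
  | comm {c : S.Chan} {tf : TPos S c → TField S T} {nf : NPos S c → NField S c}
      {k : (NPos S c → S.Val) → Term S T} (v : TPos S c → T) (w : NPos S c → S.Val) :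
      ¬ HasNdN nf → TComms tf v → NAdmissible nf w →
      Step E (.pre c tf nf k) (some ⟨c, v, w⟩) ((k w).subst (bindings .inp tf v))
  | selN {c : S.Chan} {tf : TPos S c → TField S T} {nf : NPos S c → NField S c}
      {k : (NPos S c → S.Val) → Term S T} (v : NPos S c → S.Val) :
      HasNdN nf → (∀ j X, nf j = .nd X → v j ∈ X) →
      Step E (.pre c tf nf k) none (.pre c tf (resolveN nf v) (fun w => k (chosen nf v w)))
  | selT {c : S.Chan} {tf : TPos S c → TField S T} {nf : NPos S c → NField S c}
      {k : (NPos S c → S.Val) → Term S T} (v : TPos S c → T) :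
      ¬ HasNdN nf → HasNdT tf →
      Step E (.pre c tf nf k) none ((Term.pre c (replaceT tf) nf k).subst (bindings .nd tf v))
  | extTauL {P P' Q : Term S T} : Step E P none P' → Step E (.ext P Q) none (.ext P' Q)
  | extTauR {P Q Q' : Term S T} : Step E Q none Q' → Step E (.ext P Q) none (.ext P Q')
  | extL {P P' Q : Term S T} {e : Event S T} :
      Step E P (some e) P' → Step E (.ext P Q) (some e) P'
  | extR {P Q Q' : Term S T} {e : Event S T} :
      Step E Q (some e) Q' → Step E (.ext P Q) (some e) Q'
  | intL {P Q : Term S T} : Step E (.int P Q) none P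
  | intR {P Q : Term S T} : Step E (.int P Q) none Q
  | slideOut {P Q : Term S T} : Step E (.slide P Q) none Q
  | slideTau {P P' Q : Term S T} : Step E P none P' → Step E (.slide P Q) none (.slide P' Q)
  | slideVis {P P' Q : Term S T} {e : Event S T} :
      Step E P (some e) P' → Step E (.slide P Q) (some e) P'
  | ifNTrue {P P' Q : Term S T} {a : Option (Event S T)} :
      Step E P a P' → Step E (.ifN true P Q) a P'
  | ifNFalse {P Q Q' : Term S T} {a : Option (Event S T)} :
      Step E Q a Q' → Step E (.ifN false P Q) a Q'
  | ifTTrue {g : Guard S T} {P P' Q : Term S T} {a : Option (Event S T)} :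
      g.Closed → g.Holds → Step E P a P' → Step E (.ifT g P Q) a P'
  | ifTFalse {g : Guard S T} {P Q Q' : Term S T} {a : Option (Event S T)} :
      g.Closed → ¬ g.Holds → Step E Q a Q' → Step E (.ifT g P Q) a Q'
  | call {X : S.Ident} {Γ : S.Var → Option T} : Step E (.call X Γ) none ((E X).inst Γ)

/-- The LTS of a term. -/
def Term.lts (E : Defn S) (P : Term S T) : LTS.{u, u} (Option (Event S T)) where
  State := Term S T
  start := P
  trans := Step E

/-- The process `P(T)`. -/
noncomputable def Term.proc (E : Defn S) (P : Syn S) (T : Type) : LTS.{u, u} (Option (Event S T)) :=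
  (P.inst (fun _ => none) : Term S T).lts E

end Semantics

/-! ## Semi-symbolic operational semantics -/

/-- Visible symbolic events: constructs `c§₁x₁:X₁…§_kx_k:X_k` in which the fields of type `t` are
symbolic and the other fields are outputs of values. -/
structure SEvent (S : Sig.{u}) where
  chan : S.Chan
  tf : TPos S chan → TField S Empty
  nval : NPos S chan → S.Val

/-- Labels of symbolic transitions. -/
inductive SLabel (S : Sig.{u}) : Type u
  | tau
  | vis (ε : SEvent S)
  | cond (g : Guard S Empty)

def SLabel.visible? : SLabel S → Option (SEvent S)
  | .vis ε => some ε
  | _ => none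

/-- The label is in `Visible`; otherwise it is in `Cond ∪ {τ}`. -/
def SLabel.IsVisible (l : SLabel S) : Prop := ∃ ε, l = .vis ε

/-- The transitions of the semi-symbolic operational semantics. -/
inductive SStep (E : Defn S) : Syn S → SLabel S → Syn S → Prop
  | comm {c : S.Chan} {tf : TPos S c → TField S Empty} {nf : NPos S c → NField S c}
      {k : (NPos S c → S.Val) → Syn S} (w : NPos S c → S.Val) :
      ¬ HasNdN nf → NAdmissible nf w →
      SStep E (.pre c tf nf k) (.vis ⟨c, tf, w⟩) (k w)
  | selN {c : S.Chan} {tf : TPos S c → TField S Empty} {nf : NPos S c → NField S c}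
      {k : (NPos S c → S.Val) → Syn S} (v : NPos S c → S.Val) :
      HasNdN nf → (∀ j X, nf j = .nd X → v j ∈ X) →
      SStep E (.pre c tf nf k) .tau (.pre c tf (resolveN nf v) (fun w => k (chosen nf v w)))
  | extSilentL {P P' Q : Syn S} {l : SLabel S} :
      ¬ l.IsVisible → SStep E P l P' → SStep E (.ext P Q) l (.ext P' Q)
  | extSilentR {P Q Q' : Syn S} {l : SLabel S} :
      ¬ l.IsVisible → SStep E Q l Q' → SStep E (.ext P Q) l (.ext P Q')
  | extL {P P' Q : Syn S} {ε : SEvent S} :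
      SStep E P (.vis ε) P' → SStep E (.ext P Q) (.vis ε) P'
  | extR {P Q Q' : Syn S} {ε : SEvent S} :
      SStep E Q (.vis ε) Q' → SStep E (.ext P Q) (.vis ε) Q'
  | intL {P Q : Syn S} : SStep E (.int P Q) .tau P
  | intR {P Q : Syn S} : SStep E (.int P Q) .tau Q
  | slideOut {P Q : Syn S} : SStep E (.slide P Q) .tau Q
  | slideSilent {P P' Q : Syn S} {l : SLabel S} :
      ¬ l.IsVisible → SStep E P l P' → SStep E (.slide P Q) l (.slide P' Q)
  | slideVis {P P' Q : Syn S} {ε : SEvent S} :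
      SStep E P (.vis ε) P' → SStep E (.slide P Q) (.vis ε) P'
  | ifNTrue {P P' Q : Syn S} {l : SLabel S} :
      SStep E P l P' → SStep E (.ifN true P Q) l P'
  | ifNFalse {P Q Q' : Syn S} {l : SLabel S} :
      SStep E Q l Q' → SStep E (.ifN false P Q) l Q'
  | ifTThen {g : Guard S Empty} {P Q : Syn S} : SStep E (.ifT g P Q) (.cond g) P
  | ifTElse {g : Guard S Empty} {P Q : Syn S} : SStep E (.ifT g P Q) (.cond (.not g)) Q
  | call {X : S.Ident} {Γ : S.Var → Option Empty} : SStep E (.call X Γ) .tau (E X)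

/-- The symbolic traces of `P(t)`. -/
def straces (E : Defn S) (P : Syn S) : Set (List (SLabel S)) :=
  {σ | ∃ Q, Path (SStep E) P σ Q}

/-! ## Conditions on process syntaxes -/

/-- `Within E P Q`: `Q` occurs in `P`; identifiers are unfolded. -/
inductive Within (E : Defn S) : Syn S → Syn S → Prop
  | refl (P : Syn S) : Within E P P
  | pre {c : S.Chan} {tf : TPos S c → TField S Empty} {nf : NPos S c → NField S c}
      {k : (NPos S c → S.Val) → Syn S} {R : Syn S} (w : NPos S c → S.Val) :
      NAdmissible nf w → Within E (k w) R → Within E (.pre c tf nf k) R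
  | extL {P Q R : Syn S} : Within E P R → Within E (.ext P Q) R
  | extR {P Q R : Syn S} : Within E Q R → Within E (.ext P Q) R
  | intL {P Q R : Syn S} : Within E P R → Within E (.int P Q) R
  | intR {P Q R : Syn S} : Within E Q R → Within E (.int P Q) R
  | slideL {P Q R : Syn S} : Within E P R → Within E (.slide P Q) R
  | slideR {P Q R : Syn S} : Within E Q R → Within E (.slide P Q) R
  | ifNL {b : Bool} {P Q R : Syn S} : Within E P R → Within E (.ifN b P Q) R
  | ifNR {b : Bool} {P Q R : Syn S} : Within E Q R → Within E (.ifN b P Q) R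
  | ifTL {g : Guard S Empty} {P Q R : Syn S} : Within E P R → Within E (.ifT g P Q) R
  | ifTR {g : Guard S Empty} {P Q R : Syn S} : Within E Q R → Within E (.ifT g P Q) R
  | call {X : S.Ident} {Γ : S.Var → Option Empty} {R : Syn S} :
      Within E (E X) R → Within E (.call X Γ) R

/-- `Initially E P Q`: `Q` occurs in `P` and is not after a prefix; identifiers are unfolded. -/
inductive Initially (E : Defn S) : Syn S → Syn S → Prop
  | refl (P : Syn S) : Initially E P P
  | extL {P Q R : Syn S} : Initially E P R → Initially E (.ext P Q) R
  | extR {P Q R : Syn S} : Initially E Q R → Initially E (.ext P Q) R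
  | intL {P Q R : Syn S} : Initially E P R → Initially E (.int P Q) R
  | intR {P Q R : Syn S} : Initially E Q R → Initially E (.int P Q) R
  | slideL {P Q R : Syn S} : Initially E P R → Initially E (.slide P Q) R
  | slideR {P Q R : Syn S} : Initially E Q R → Initially E (.slide P Q) R
  | ifNL {b : Bool} {P Q R : Syn S} : Initially E P R → Initially E (.ifN b P Q) R
  | ifNR {b : Bool} {P Q R : Syn S} : Initially E Q R → Initially E (.ifN b P Q) R
  | ifTL {g : Guard S Empty} {P Q R : Syn S} : Initially E P R → Initially E (.ifT g P Q) R
  | ifTR {g : Guard S Empty} {P Q R : Syn S} : Initially E Q R → Initially E (.ifT g P Q) R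
  | call {X : S.Ident} {Γ : S.Var → Option Empty} {R : Syn S} :
      Initially E (E X) R → Initially E (.call X Γ) R

/-- The variable `x` occurs in the condition. -/
def Guard.Mentions (x : S.Var) : Guard S Empty → Prop
  | .eq a b => a = .inl x ∨ b = .inl x
  | .not g => g.Mentions x
  | .and g h => g.Mentions x ∨ h.Mentions x
  | .or g h => g.Mentions x ∨ h.Mentions x

/-- `FreeIn E x P`: the variable `x` of type `t` occurs free in `P`; identifiers are unfolded. -/
inductive FreeIn (E : Defn S) (x : S.Var) : Syn S → Prop
  | out {c : S.Chan} {tf : TPos S c → TField S Empty} {nf : NPos S c → NField S c}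
      {k : (NPos S c → S.Val) → Syn S} (i : TPos S c) :
      tf i = .out (.inl x) → FreeIn E x (.pre c tf nf k)
  | cont {c : S.Chan} {tf : TPos S c → TField S Empty} {nf : NPos S c → NField S c}
      {k : (NPos S c → S.Val) → Syn S} (w : NPos S c → S.Val) :
      NAdmissible nf w → ¬ Binds tf x → FreeIn E x (k w) → FreeIn E x (.pre c tf nf k)
  | extL {P Q : Syn S} : FreeIn E x P → FreeIn E x (.ext P Q)
  | extR {P Q : Syn S} : FreeIn E x Q → FreeIn E x (.ext P Q)
  | intL {P Q : Syn S} : FreeIn E x P → FreeIn E x (.int P Q)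
  | intR {P Q : Syn S} : FreeIn E x Q → FreeIn E x (.int P Q)
  | slideL {P Q : Syn S} : FreeIn E x P → FreeIn E x (.slide P Q)
  | slideR {P Q : Syn S} : FreeIn E x Q → FreeIn E x (.slide P Q)
  | ifNL {b : Bool} {P Q : Syn S} : FreeIn E x P → FreeIn E x (.ifN b P Q)
  | ifNR {b : Bool} {P Q : Syn S} : FreeIn E x Q → FreeIn E x (.ifN b P Q)
  | ifTCond {g : Guard S Empty} {P Q : Syn S} : g.Mentions x → FreeIn E x (.ifT g P Q)
  | ifTL {g : Guard S Empty} {P Q : Syn S} : FreeIn E x P → FreeIn E x (.ifT g P Q)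
  | ifTR {g : Guard S Empty} {P Q : Syn S} : FreeIn E x Q → FreeIn E x (.ifT g P Q)
  | call {X : S.Ident} {Γ : S.Var → Option Empty} : FreeIn E x (E X) → FreeIn E x (.call X Γ)

/-- `P(t)` has no free variables other than `t`, so that every `P(T)` is a closed term. -/
def IsClosed (E : Defn S) (P : Syn S) : Prop := ∀ x, ¬ FreeIn E x P

/-- The initial channels of `P`. -/
def channels (E : Defn S) (P : Syn S) : Set S.Chan :=
  {c | ∃ tf nf k, Initially E P (.pre c tf nf k)}

/-- `x` is the variable of a nondeterministic selection `$x:t` in an initial construct of `P`. -/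
def InitialNdVar (E : Defn S) (P : Syn S) (x : S.Var) : Prop :=
  ∃ c tf nf k, Initially E P (.pre c tf nf k) ∧ ∃ i, tf i = .nd x

/-- `P` and `Q` have no clash between a nondeterministic-selection variable of one and a free
variable of the other. -/
def NoClash (E : Defn S) (P Q : Syn S) : Prop :=
  ∀ x, ¬ (InitialNdVar E P x ∧ FreeIn E x Q) ∧ ¬ (InitialNdVar E Q x ∧ FreeIn E x P)

/-- The conditions of **Seq** that are not built into `Syn S`. -/
structure IsSeq (E : Defn S) (P : Syn S) : Prop where
  /-- No clashes between the arguments of external and sliding choices. -/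
  ext_noClash : ∀ A B, Within E P (.ext A B) → NoClash E A B
  slide_noClash : ∀ A B, Within E P (.slide A B) → NoClash E A B
  /-- An input variable of type `t` occurs only once in a construct. -/
  once : ∀ c tf nf k, Within E P (.pre c tf nf k) → ∀ i x, (tf i = .nd x ∨ tf i = .inp x) →
    ∀ j, (tf j = .nd x ∨ tf j = .inp x ∨ tf j = .out (.inl x)) → i = j
  /-- An output not of type `t` mentions no variables of its construct except input variables. -/
  outputs : ∀ c tf nf k, Within E P (.pre c tf nf k) → ∀ j f, nf j = .out f →
    ∀ w w' : NPos S c → S.Val, (∀ l, (∀ f', nf l ≠ .out f') → w l = w' l) → f w = f w'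

/-- The two requirements of **SeqNorm** for the arguments of a choice. -/
def NormChoice (E : Defn S) (A B : Syn S) : Prop :=
  Disjoint (channels E A) (channels E B) ∧
  (∀ g P Q, ¬ Initially E A (.ifT g P Q)) ∧ (∀ g P Q, ¬ Initially E B (.ifT g P Q))

/-- **SeqNorm**. -/
structure IsSeqNorm (E : Defn S) (P : Syn S) : Prop extends IsSeq E P where
  ext_norm : ∀ A B, Within E P (.ext A B) → NormChoice E A B
  int_norm : ∀ A B, Within E P (.int A B) → NormChoice E A B
  slide_norm : ∀ A B, Within E P (.slide A B) → NormChoice E A B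

/-- The condition is a positive conjunction of equality tests. -/
def Guard.PosConj : Guard S Empty → Prop
  | .eq _ _ => True
  | .not _ => False
  | .and g h => g.PosConj ∧ h.PosConj
  | .or _ _ => False

/-- **RevPosConjEqT** for the stable failures model.  Instantiations of `t` are the non-empty initial
segments `{0, …, n - 1}` of the natural numbers. -/
def RevPosConjEqTF (E : Defn S) (P : Syn S) : Prop :=
  ∀ g A B, Within E P (.ifT g A B) → g.PosConj ∧
    ∀ n : ℕ, 1 ≤ n → ∀ γ : S.Var → Fin n,
      LTS.Refined ((B.inst fun x => some (γ x)).lts E) ((A.inst fun x => some (γ x)).lts E)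

/-- No construct combines nondeterministic selections of type `t` with deterministic inputs of any
type. -/
def NoMixedConstruct (E : Defn S) (P : Syn S) : Prop :=
  ∀ c tf nf k, Within E P (.pre c tf nf k) → HasNdT tf →
    (∀ i x, tf i ≠ .inp x) ∧ (∀ j X, nf j ≠ .inp X)

/-- **TypeSym**, for a family of processes indexed by the instantiations of `t`. -/
def TypeSym (I : (n : ℕ) → LTS.{u, v} (Option (Event S (Fin n)))) : Prop :=
  ∀ n : ℕ, 1 ≤ n → ∀ π : Equiv.Perm (Fin n), (I n).Bisimilar ((I n).rename (Event.map π))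

/-- `φ` is a `B`-collapsing function from `{0, …, n - 1}` to `{0, …, B}`. -/
def IsCollapsing (B : ℕ) {n : ℕ} (φ : Fin n → Fin (B + 1)) : Prop :=
  ∀ v : Fin n, ((v : ℕ) < B → ((φ v : Fin (B + 1)) : ℕ) = v) ∧
    (B ≤ (v : ℕ) → ((φ v : Fin (B + 1)) : ℕ) = B)

/-! ## The threshold -/

/-- `!ᵗ(ε)`: the positions of the outputs of type `t`. -/
def SEvent.outT (ε : SEvent S) : Set ℕ :=
  {p | ∃ (i : TPos S ε.chan) (a : Atom S Empty), ((i : Fin (S.arity ε.chan)) : ℕ) = p ∧ ε.tf i = .out a}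

/-- `?ᵗ(ε)`: the positions of the deterministic inputs of type `t`. -/
def SEvent.inT (ε : SEvent S) : Set ℕ :=
  {p | ∃ (i : TPos S ε.chan) (x : S.Var), ((i : Fin (S.arity ε.chan)) : ℕ) = p ∧ ε.tf i = .inp x}

/-- The channel and the fields not of type `t`. -/
def SEvent.nonT (ε : SEvent S) : (c : S.Chan) × (NPos S c → S.Val) := ⟨ε.chan, ε.nval⟩

/-- Non-`t` equivalence of symbolic traces: the visible symbolic events agree, one by one, on the
channel and on all the fields not of type `t`. -/
def NonTEquiv (σ σ' : List (SLabel S)) : Prop :=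
  (σ.filterMap SLabel.visible?).map SEvent.nonT = (σ'.filterMap SLabel.visible?).map SEvent.nonT

/-- `!ᵗ(σ, ε)(P(t))`. -/
def outPositions (E : Defn S) (P : Syn S) (σ : List (SLabel S)) (ε : SEvent S) : Set ℕ :=
  {p | ∃ σ' ε', σ' ++ [.vis ε'] ∈ straces E P ∧ NonTEquiv (σ ++ [.vis ε]) (σ' ++ [.vis ε']) ∧
    p ∈ SEvent.outT ε'}

/-- `Thresh_T`, with value `⊤` if there is no maximum. -/
noncomputable def threshT (E : Defn S) (P : Syn S) : ℕ∞ :=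
  ⨆ (σ : List (SLabel S)) (ε : SEvent S) (_ : σ ++ [.vis ε] ∈ straces E P),
    (outPositions E P σ ε).encard

/-- All the conditions in `ρ` are defined and true in the environment `Γ`. -/
def EvalTrue {T : Type} (Γ : S.Var → Option T) (ρ : List (SLabel S)) : Prop :=
  ∀ g, SLabel.cond g ∈ ρ → ((g.embed : Guard S T).subst Γ).Closed ∧
    ((g.embed : Guard S T).subst Γ).Holds

/-- The visible symbolic events available in `P(t)` immediately after `σ`, such that all the
conditions between the end of `σ` and the event are true in `Γ`. -/
def available (E : Defn S) (P : Syn S) {T : Type} (σ : List (SLabel S)) (Γ : S.Var → Option T) :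
    Set (SEvent S) :=
  {ε | ∃ Q ρ R R', Path (SStep E) P σ Q ∧ Path (SStep E) Q ρ R ∧
    (∀ l ∈ ρ, ¬ l.IsVisible) ∧ EvalTrue Γ ρ ∧ SStep E R (.vis ε) R'}

/-- `Thresh_{!ᵗ}(σ, Γ)`: the number of distinct output variables of type `t`. -/
noncomputable def threshOut (E : Defn S) (P : Syn S) {T : Type} (σ : List (SLabel S))
    (Γ : S.Var → Option T) : ℕ∞ :=
  {x : S.Var | ∃ ε ∈ available E P σ Γ, ∃ i, ε.tf i = .out (.inl x)}.encard

/-- `Thresh_{?ᵗ}(σ, Γ)`: the sum of `#?ᵗ(ε)` over the available `ε` (as the supremum of the finite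
partial sums). -/
noncomputable def threshIn (E : Defn S) (P : Syn S) {T : Type} (σ : List (SLabel S))
    (Γ : S.Var → Option T) : ℕ∞ :=
  ⨆ (F : Finset (SEvent S)) (_ : (F : Set (SEvent S)) ⊆ available E P σ Γ),
    ∑ ε ∈ F, (SEvent.inT ε).encard

/-- `Thresh`, for the instantiation `T` of `t`. -/
noncomputable def thresh (E : Defn S) (P : Syn S) (T : Type) : ℕ∞ :=
  max (threshT E P)
    (⨆ (σ : List (SLabel S)) (_ : σ ∈ straces E P)
      (_ : σ = [] ∨ ∃ l, σ.getLast? = some l ∧ l.IsVisible) (Γ : S.Var → Option T),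
      threshOut E P σ Γ + threshIn E P σ Γ)

end CSP

namespace CSP

variable {S : Sig.{u}} {T : Type}

/-! ## Substitution lemmas -/

/-! By symmetry of the implementation in the values of `t`, the hypothesis on the single collapse
`φ` gives the same for every `φ ∘ π` with `π` a permutation of `T` (`TypeSym.refined`). So every
behaviour of the implementation comes with a whole family of collapsed images, all of them
behaviours of the specification over `{0, …, B}`. The specification is normal enough, and `B` large
enough, that the uncollapsed behaviour can be recovered from a well-chosen image.

States of the specification are treated as configurations: a process syntax with a valuation `γ` of
its variables. For any map `ψ` of values, a configuration `(P, γ)` and its image `(P, ψ ∘ γ)` can be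
run in step. In a choice, the disjointness of initial channels makes the channel of the event
determine the argument. In a conditional, a true conjunction of equalities stays true under `ψ`; if
it is false and becomes true, the first branch refines the second, so whatever the image does
through the first branch it can also do through the second. Hence a behaviour of the image that
starts with the image of a trace continues as a behaviour of the image of the configuration which
that trace reaches (`Init.behav_comp`, `Behav.of_path`).

Traces are extended one event `e` at a time (`CConv.exists_cStep`). Any one image of `e` already
shows that a construct on the right channel is available and that the fields not of type `t` fit.
For the output fields, `π` is chosen to send the values that `e` has there below `B`, which is
possible because they number at most `Thresh_T`. A value sent below `B` is the only one in its
collapse class, so equality of images gives equality with the value of the output variable.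

For failures one `π` has to serve all the available constructs at once (`CConv.cFail`). It separates
the values of all available output variables and, for every available symbolic event that could
perform a refused event, the input values of one such event; the second maximum in the threshold
bounds their number. With those values separated, the refusal lifts from the image back to the
configuration (`CFail.of_comp`). The ban on mixing selections and inputs is needed here: a resolved
selection then leaves only one event to be lifted.

Divergence-freedom enters as convergence: the unfolding of initial identifiers terminates, so
induction over the initial structure of a reachable state is available. The remaining lemmas relate
the operational semantics to configurations, through a big-step semantics that hides the order of
internal steps. -/

theorem Atom.subst_none (a : Atom S T) : Atom.subst (fun _ => none) a = a := by
  cases a <;> rfl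

theorem Atom.subst_subst (Γ Δ : S.Var → Option T) (a : Atom S T) :
    Atom.subst Δ (Atom.subst Γ a) = Atom.subst (fun x => (Γ x).or (Δ x)) a := by
  rcases a with x | v
  · simp only [Atom.subst]
    cases h : Γ x <;> simp
  · rfl

theorem TField.subst_none (a : TField S T) : a.subst (fun _ => none) = a := by
  cases a <;> simp [TField.subst, Atom.subst_none]

theorem TField.subst_subst (Γ Δ : S.Var → Option T) (a : TField S T) :
    (a.subst Γ).subst Δ = a.subst (fun x => (Γ x).or (Δ x)) := by
  cases a <;> simp [TField.subst, Atom.subst_subst]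

theorem TField.subst_eq_nd {Γ : S.Var → Option T} {a : TField S T} {x : S.Var} :
    a.subst Γ = .nd x ↔ a = .nd x := by
  cases a <;> simp [TField.subst]

theorem TField.subst_eq_inp {Γ : S.Var → Option T} {a : TField S T} {x : S.Var} :
    a.subst Γ = .inp x ↔ a = .inp x := by
  cases a <;> simp [TField.subst]

theorem TField.embed_eq_nd {a : TField S Empty} {x : S.Var} :
    (a.embed : TField S T) = .nd x ↔ a = .nd x := by
  cases a <;> simp [TField.embed]

theorem TField.embed_eq_inp {a : TField S Empty} {x : S.Var} :
    (a.embed : TField S T) = .inp x ↔ a = .inp x := by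
  cases a <;> simp [TField.embed]

theorem Guard.subst_none (g : Guard S T) : g.subst (fun _ => none) = g := by
  induction g <;> simp_all [Guard.subst, Atom.subst_none]

theorem Guard.subst_subst (Γ Δ : S.Var → Option T) (g : Guard S T) :
    (g.subst Γ).subst Δ = g.subst (fun x => (Γ x).or (Δ x)) := by
  induction g <;> simp_all [Guard.subst, Atom.subst_subst]

theorem binds_subst {c : S.Chan} {tf : TPos S c → TField S T} {Γ : S.Var → Option T} {x : S.Var} :
    Binds (fun i => (tf i).subst Γ) x ↔ Binds tf x := by
  simp [Binds, TField.subst_eq_nd, TField.subst_eq_inp]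

theorem binds_embed {c : S.Chan} {tf : TPos S c → TField S Empty} {x : S.Var} :
    Binds (fun i => ((tf i).embed : TField S T)) x ↔ Binds tf x := by
  simp [Binds, TField.embed_eq_nd, TField.embed_eq_inp]

theorem Term.subst_none (P : Term S T) : P.subst (fun _ => none) = P := by
  induction P with
  | pre c tf nf k ih => simp [Term.subst, TField.subst_none, ih]
  | _ => simp_all [Term.subst, Guard.subst_none]

theorem Term.subst_subst (P : Term S T) (Γ Δ : S.Var → Option T) :
    (P.subst Γ).subst Δ = P.subst (fun x => (Γ x).or (Δ x)) := by
  induction P generalizing Γ Δ with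
  | pre c tf nf k ih =>
    simp only [Term.subst, TField.subst_subst, ih, binds_subst]
    congr 1
    funext w
    congr 1
    funext x
    by_cases hx : Binds tf x
    · simp [hx, binds_subst]
    · simp [hx, binds_subst]
  | call X Θ => simp [Term.subst, Option.or_assoc]
  | _ => simp_all [Term.subst, Guard.subst_subst]

theorem bindings_congr {c : S.Chan} {b : S.Var → TField S T} {tf tf' : TPos S c → TField S T}
    (h : ∀ i x, tf i = b x ↔ tf' i = b x) (v : TPos S c → T) :
    bindings b tf v = bindings b tf' v := by
  funext x
  -- The chosen position depends on the predicate itself, so the two predicates have to be made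
  -- equal and not merely equivalent.
  have aux : ∀ p q : TPos S c → Prop, p = q → ∀ (_ : Decidable (∃ i, p i)) (_ : Decidable (∃ i, q i)),
      (if h : ∃ i, p i then some (v h.choose) else none) =
        if h : ∃ i, q i then some (v h.choose) else none := by
    rintro p q rfl _ _
    congr
  exact aux (fun i => tf i = b x) (fun i => tf' i = b x) (funext fun i => propext (h i x)) _ _

theorem bindings_none {c : S.Chan} {b : S.Var → TField S T} {tf : TPos S c → TField S T}
    (h : ∀ i x, tf i ≠ b x) (v : TPos S c → T) : bindings b tf v = fun _ => none := by
  funext x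
  simp [bindings, h]

/-- The fields of type `t` after the selections `$x:t` have been resolved by `v`. -/
noncomputable def resolveT {c : S.Chan} (tf : TPos S c → TField S T) (v : TPos S c → T) :
    TPos S c → TField S T :=
  fun i => (replaceT tf i).subst (bindings .nd tf v)

/-- What a prefix construct continues as, when the selections have been resolved by `v` and the
event has the values `v'` at the positions of type `t`. -/
noncomputable def contT {c : S.Chan} (tf : TPos S c → TField S T) (v v' : TPos S c → T)
    (P : Term S T) : Term S T :=
  open Classical in
  (P.subst (fun x => if Binds (replaceT tf) x then none else bindings .nd tf v x)).subst
    (bindings .inp tf v')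

theorem replaceT_ne_nd {c : S.Chan} (tf : TPos S c → TField S T) (i : TPos S c) (x : S.Var) :
    replaceT tf i ≠ .nd x := by
  unfold replaceT
  cases tf i <;> simp

theorem replaceT_eq_inp {c : S.Chan} {tf : TPos S c → TField S T} {i : TPos S c} {x : S.Var} :
    replaceT tf i = .inp x ↔ tf i = .inp x := by
  unfold replaceT
  cases tf i <;> simp

theorem resolveT_ne_nd {c : S.Chan} (tf : TPos S c → TField S T) (v : TPos S c → T) (i : TPos S c)
    (x : S.Var) : resolveT tf v i ≠ .nd x := by
  simp [resolveT, TField.subst_eq_nd, replaceT_ne_nd]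

theorem resolveT_eq_inp {c : S.Chan} {tf : TPos S c → TField S T} {v : TPos S c → T} {i : TPos S c}
    {x : S.Var} : resolveT tf v i = .inp x ↔ tf i = .inp x := by
  simp [resolveT, TField.subst_eq_inp, replaceT_eq_inp]

theorem not_hasNdT_resolveT {c : S.Chan} (tf : TPos S c → TField S T) (v : TPos S c → T) :
    ¬ HasNdT (resolveT tf v) := by
  rintro ⟨i, x, h⟩
  exact resolveT_ne_nd tf v i x h

theorem replaceT_of_not_hasNdT {c : S.Chan} {tf : TPos S c → TField S T} (h : ¬ HasNdT tf) :
    replaceT tf = tf := by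
  funext i
  unfold replaceT
  cases h' : tf i with
  | nd x => exact (h ⟨i, x, h'⟩).elim
  | _ => rfl

theorem bindings_nd_of_not_hasNdT {c : S.Chan} {tf : TPos S c → TField S T} (h : ¬ HasNdT tf)
    (v : TPos S c → T) : bindings .nd tf v = fun _ => none :=
  bindings_none (fun i x h' => h ⟨i, x, h'⟩) v

theorem resolveT_of_not_hasNdT {c : S.Chan} {tf : TPos S c → TField S T} (h : ¬ HasNdT tf)
    (v : TPos S c → T) : resolveT tf v = tf := by
  funext i
  simp [resolveT, bindings_nd_of_not_hasNdT h, TField.subst_none, replaceT_of_not_hasNdT h]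

theorem contT_of_not_hasNdT {c : S.Chan} {tf : TPos S c → TField S T} (h : ¬ HasNdT tf)
    (v v' : TPos S c → T) (P : Term S T) : contT tf v v' P = P.subst (bindings .inp tf v') := by
  simp [contT, bindings_nd_of_not_hasNdT h, Term.subst_none]

/-! ## Resolution of the selections not of type `t` -/

theorem not_hasNdN_resolveN {c : S.Chan} (nf : NPos S c → NField S c) (v : NPos S c → S.Val) :
    ¬ HasNdN (resolveN nf v) := by
  rintro ⟨j, X, h⟩
  revert h
  unfold resolveN
  cases nf j <;> simp

theorem chosen_eq {c : S.Chan} {nf : NPos S c → NField S c} {v w : NPos S c → S.Val}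
    (h : ∀ j X, nf j = .nd X → w j = v j) : chosen nf v w = w := by
  funext j
  unfold chosen
  cases h' : nf j with
  | nd X => exact (h j X h').symm
  | _ => rfl

/-- The outputs of `resolveN nf v` read their arguments through `chosen nf v`, which is the identity
on tuples that already agree with `v` at the selections. -/
theorem nAdmissible_resolveN {c : S.Chan} {nf : NPos S c → NField S c} {v w : NPos S c → S.Val}
    (hv : ∀ j X, nf j = .nd X → v j ∈ X) :
    NAdmissible (resolveN nf v) w ↔ NAdmissible nf w ∧ ∀ j X, nf j = .nd X → w j = v j := by
  constructor
  · intro h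
    have hnd : ∀ j X, nf j = .nd X → w j = v j := by
      intro j X hj
      have := h j
      simpa [resolveN, hj] using this
    refine ⟨fun j => ?_, hnd⟩
    have := h j
    simp only [resolveN] at this
    cases hj : nf j with
    | nd X => simpa [hnd j X hj] using hv j X hj
    | inp X => simpa [hj] using this
    | out f => simpa [hj, chosen_eq hnd] using this
  · rintro ⟨h, hnd⟩ j
    have := h j
    simp only [resolveN]
    cases hj : nf j with
    | nd X => simpa using hnd j X hj
    | inp X => simpa [hj] using this
    | out f => simpa [hj, chosen_eq hnd] using this

theorem NAdmissible.nd_mem {c : S.Chan} {nf : NPos S c → NField S c} {w : NPos S c → S.Val}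
    (h : NAdmissible nf w) (j : NPos S c) (X : Set S.Val) (hj : nf j = .nd X) : w j ∈ X := by
  have := h j
  simpa [hj] using this

/-! ## Big-step semantics of terms -/

/-- `BStep E P e P'`: after some internal events, `P` performs `e` and becomes `P'`. -/
inductive BStep (E : Defn S) : Term S T → Event S T → Term S T → Prop
  | pre {c : S.Chan} {tf : TPos S c → TField S T} {nf : NPos S c → NField S c}
      {k : (NPos S c → S.Val) → Term S T} (v v' : TPos S c → T) (w : NPos S c → S.Val) :
      NAdmissible nf w → TComms (resolveT tf v) v' →
      BStep E (.pre c tf nf k) ⟨c, v', w⟩ (contT tf v v' (k w))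
  | extL {P P' Q : Term S T} {e : Event S T} : BStep E P e P' → BStep E (.ext P Q) e P'
  | extR {P Q Q' : Term S T} {e : Event S T} : BStep E Q e Q' → BStep E (.ext P Q) e Q'
  | intL {P P' Q : Term S T} {e : Event S T} : BStep E P e P' → BStep E (.int P Q) e P'
  | intR {P Q Q' : Term S T} {e : Event S T} : BStep E Q e Q' → BStep E (.int P Q) e Q'
  | slideL {P P' Q : Term S T} {e : Event S T} : BStep E P e P' → BStep E (.slide P Q) e P'
  | slideR {P Q Q' : Term S T} {e : Event S T} : BStep E Q e Q' → BStep E (.slide P Q) e Q'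
  | ifNTrue {P P' Q : Term S T} {e : Event S T} : BStep E P e P' → BStep E (.ifN true P Q) e P'
  | ifNFalse {P Q Q' : Term S T} {e : Event S T} : BStep E Q e Q' → BStep E (.ifN false P Q) e Q'
  | ifTTrue {g : Guard S T} {P P' Q : Term S T} {e : Event S T} :
      g.Closed → g.Holds → BStep E P e P' → BStep E (.ifT g P Q) e P'
  | ifTFalse {g : Guard S T} {P Q Q' : Term S T} {e : Event S T} :
      g.Closed → ¬ g.Holds → BStep E Q e Q' → BStep E (.ifT g P Q) e Q'
  | call {X : S.Ident} {Γ : S.Var → Option T} {P' : Term S T} {e : Event S T} :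
      BStep E ((E X).inst Γ) e P' → BStep E (.call X Γ) e P'

/-- `Fail E X P`: after some internal events, `P` is stable and refuses `X`. -/
inductive Fail (E : Defn S) (X : Set (Event S T)) : Term S T → Prop
  | deadlock : Fail E X .STOP
  | stuck {c : S.Chan} {tf : TPos S c → TField S T} {nf : NPos S c → NField S c}
      {k : (NPos S c → S.Val) → Term S T} :
      (¬ ∃ u : NPos S c → S.Val, ∀ j Y, nf j = .nd Y → u j ∈ Y) → Fail E X (.pre c tf nf k)
  | pre {c : S.Chan} {tf : TPos S c → TField S T} {nf : NPos S c → NField S c}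
      {k : (NPos S c → S.Val) → Term S T} (u : NPos S c → S.Val) (v : TPos S c → T) :
      (∀ j Y, nf j = .nd Y → u j ∈ Y) →
      (∀ v' w, NAdmissible nf w → (∀ j Y, nf j = .nd Y → w j = u j) → TComms (resolveT tf v) v' →
        (⟨c, v', w⟩ : Event S T) ∉ X) →
      Fail E X (.pre c tf nf k)
  | ext {P Q : Term S T} : Fail E X P → Fail E X Q → Fail E X (.ext P Q)
  | intL {P Q : Term S T} : Fail E X P → Fail E X (.int P Q)
  | intR {P Q : Term S T} : Fail E X Q → Fail E X (.int P Q)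
  | slide {P Q : Term S T} : Fail E X Q → Fail E X (.slide P Q)
  | ifNTrue {P Q : Term S T} : Fail E X P → Fail E X (.ifN true P Q)
  | ifNFalse {P Q : Term S T} : Fail E X Q → Fail E X (.ifN false P Q)
  | ifTTrue {g : Guard S T} {P Q : Term S T} :
      g.Closed → g.Holds → Fail E X P → Fail E X (.ifT g P Q)
  | ifTFalse {g : Guard S T} {P Q : Term S T} :
      g.Closed → ¬ g.Holds → Fail E X Q → Fail E X (.ifT g P Q)
  | ifTOpen {g : Guard S T} {P Q : Term S T} : ¬ g.Closed → Fail E X (.ifT g P Q)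
  | call {Y : S.Ident} {Γ : S.Var → Option T} : Fail E X ((E Y).inst Γ) → Fail E X (.call Y Γ)

/-- The internal transitions. -/
def Tau (E : Defn S) (P Q : Term S T) : Prop := Step E P none Q

theorem BStep.of_step {E : Defn S} {P P' : Term S T} {e : Event S T}
    (h : Step E P (some e) P') : BStep E P e P' := by
  generalize ha : some e = a at h
  induction h with
  | @comm c tf nf k v w h1 h2 h3 =>
    cases ha
    have hn : ¬ HasNdT tf := by
      rintro ⟨i, x, hi⟩
      have := h2 i
      simp [hi] at this
    rw [← contT_of_not_hasNdT hn v v]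
    exact .pre v v w h3 (by rwa [resolveT_of_not_hasNdT hn])
  | selN => cases ha
  | selT => cases ha
  | extTauL => cases ha
  | extTauR => cases ha
  | extL _ ih => cases ha; exact .extL (ih rfl)
  | extR _ ih => cases ha; exact .extR (ih rfl)
  | intL => cases ha
  | intR => cases ha
  | slideOut => cases ha
  | slideTau => cases ha
  | slideVis _ ih => cases ha; exact .slideL (ih rfl)
  | ifNTrue _ ih => exact .ifNTrue (ih ha)
  | ifNFalse _ ih => exact .ifNFalse (ih ha)
  | ifTTrue h1 h2 _ ih => exact .ifTTrue h1 h2 (ih ha)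
  | ifTFalse h1 h2 _ ih => exact .ifTFalse h1 h2 (ih ha)
  | call => cases ha

/-- Big steps, and likewise `Fail`, are closed backwards under internal steps, so a sequence of
small steps can be absorbed starting from its end. -/
theorem BStep.of_tau {E : Defn S} {P Q R : Term S T} {e : Event S T}
    (h : Tau E P Q) (hQ : BStep E Q e R) : BStep E P e R := by
  unfold Tau at h
  generalize ha : none = a at h
  induction h generalizing R with
  | comm => cases ha
  | @selN c tf nf k v h1 h2 =>
    cases hQ with
    | pre v0 v' w hw ht =>
      rw [nAdmissible_resolveN h2] at hw
      beta_reduce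
      rw [chosen_eq hw.2]
      exact .pre v0 v' w hw.1 ht
  | @selT c tf nf k v h1 h2 =>
    change BStep E (Term.pre c (resolveT tf v) nf _) e R at hQ
    cases hQ with
    | pre v0 v' w hw ht =>
      rw [contT_of_not_hasNdT (not_hasNdT_resolveT tf v)]
      rw [resolveT_of_not_hasNdT (not_hasNdT_resolveT tf v)] at ht
      rw [bindings_congr (tf' := tf) (fun i x => resolveT_eq_inp)]
      exact .pre v v' w hw ht
  | extTauL _ ih =>
    cases hQ with
    | extL h => exact .extL (ih h ha)
    | extR h => exact .extR h
  | extTauR _ ih =>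
    cases hQ with
    | extL h => exact .extL h
    | extR h => exact .extR (ih h ha)
  | extL => cases ha
  | extR => cases ha
  | intL => exact .intL hQ
  | intR => exact .intR hQ
  | slideOut => exact .slideR hQ
  | slideTau _ ih =>
    cases hQ with
    | slideL h => exact .slideL (ih h ha)
    | slideR h => exact .slideR h
  | slideVis => cases ha
  | ifNTrue _ ih => exact .ifNTrue (ih hQ ha)
  | ifNFalse _ ih => exact .ifNFalse (ih hQ ha)
  | ifTTrue h1 h2 _ ih => exact .ifTTrue h1 h2 (ih hQ ha)
  | ifTFalse h1 h2 _ ih => exact .ifTFalse h1 h2 (ih hQ ha)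
  | call => exact .call hQ

theorem Fail.of_tau {E : Defn S} {X : Set (Event S T)} {P Q : Term S T}
    (h : Tau E P Q) (hQ : Fail E X Q) : Fail E X P := by
  unfold Tau at h
  generalize ha : none = a at h
  induction h with
  | comm => cases ha
  | @selN c tf nf k v h1 h2 =>
    cases hQ with
    | stuck h => exact (h ⟨v, fun j Y hj => (not_hasNdN_resolveN nf v ⟨j, Y, hj⟩).elim⟩).elim
    | pre u0 v0 _ hX =>
      refine .pre v v0 h2 fun v' w hw hwv ht => hX v' w ?_ ?_ ht
      · exact (nAdmissible_resolveN h2).2 ⟨hw, hwv⟩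
      · exact fun j Y hj => (not_hasNdN_resolveN nf v ⟨j, Y, hj⟩).elim
  | @selT c tf nf k v h1 h2 =>
    change Fail E X (Term.pre c (resolveT tf v) nf _) at hQ
    cases hQ with
    | stuck h => exact .stuck h
    | pre u0 v0 hu hX =>
      rw [resolveT_of_not_hasNdT (not_hasNdT_resolveT tf v)] at hX
      exact .pre u0 v hu hX
  | extTauL _ ih =>
    cases hQ with
    | ext h h' => exact .ext (ih h ha) h'
  | extTauR _ ih =>
    cases hQ with
    | ext h h' => exact .ext h (ih h' ha)
  | extL => cases ha
  | extR => cases ha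
  | intL => exact .intL hQ
  | intR => exact .intR hQ
  | slideOut => exact .slide hQ
  | slideTau _ ih =>
    cases hQ with
    | slide h => exact .slide h
  | slideVis => cases ha
  | ifNTrue _ ih => exact .ifNTrue (ih hQ ha)
  | ifNFalse _ ih => exact .ifNFalse (ih hQ ha)
  | ifTTrue h1 h2 _ ih => exact .ifTTrue h1 h2 (ih hQ ha)
  | ifTFalse h1 h2 _ ih => exact .ifTFalse h1 h2 (ih hQ ha)
  | call => exact .call hQ

/-! ## Big steps are weak transitions -/

/-- Finitely many internal transitions. -/
abbrev Taus (E : Defn S) : Term S T → Term S T → Prop := Relation.ReflTransGen (Tau E)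

theorem Taus.map {E : Defn S} {P P' : Term S T} (f : Term S T → Term S T)
    (hf : ∀ A B, Tau E A B → Tau E (f A) (f B)) (h : Taus E P P') : Taus E (f P) (f P') := by
  induction h with
  | refl => exact .refl
  | tail _ hs ih => exact ih.tail (hf _ _ hs)

/-- If every transition of `P` is one of `f P`, then a weak transition of `P` is one of `f P`. -/
theorem Taus.lift {E : Defn S} {P R : Term S T} {b : Option (Event S T)} {P' R' : Term S T}
    (hf : ∀ a A, Step E P a A → Step E R a A) (h : Taus E P P') (hs : Step E P' b R') :
    ∃ R'', Taus E R R'' ∧ Step E R'' b R' := by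
  rcases Relation.ReflTransGen.cases_head h with rfl | ⟨Q, hq, hQ⟩
  · exact ⟨R, .refl, hf _ _ hs⟩
  · exact ⟨P', .head (hf _ _ hq) hQ, hs⟩

/-- A prefix construct resolves its selections. -/
theorem exists_taus_pre {E : Defn S} {c : S.Chan} (tf : TPos S c → TField S T)
    (nf : NPos S c → NField S c) (k : (NPos S c → S.Val) → Term S T) (u : NPos S c → S.Val)
    (v : TPos S c → T) (hu : ∀ j Y, nf j = .nd Y → u j ∈ Y) :
    ∃ nf' k', Taus E (.pre c tf nf k) (.pre c (resolveT tf v) nf' k') ∧ ¬ HasNdN nf' ∧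
      (∀ w, NAdmissible nf' w ↔ NAdmissible nf w ∧ ∀ j Y, nf j = .nd Y → w j = u j) ∧
      ∀ w v', NAdmissible nf' w → (k' w).subst (bindings .inp tf v') = contT tf v v' (k w) := by
  have stage2 : ∀ (nf : NPos S c → NField S c) (k : (NPos S c → S.Val) → Term S T),
      ¬ HasNdN nf → ∃ k', Taus E (.pre c tf nf k) (.pre c (resolveT tf v) nf k') ∧
        ∀ w v', (k' w).subst (bindings .inp tf v') = contT tf v v' (k w) := by
    intro nf k hnf
    by_cases ht : HasNdT tf
    · exact ⟨_, .single (Step.selT v hnf ht), fun w v' => rfl⟩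
    · rw [resolveT_of_not_hasNdT ht]
      exact ⟨k, .refl, fun w v' => (contT_of_not_hasNdT ht v v' _).symm⟩
  by_cases hN : HasNdN nf
  · obtain ⟨k', h1, h2⟩ := stage2 (resolveN nf u) (fun w => k (chosen nf u w))
      (not_hasNdN_resolveN nf u)
    refine ⟨_, k', .head (Step.selN u hN hu) h1, not_hasNdN_resolveN nf u,
      fun w => nAdmissible_resolveN hu, fun w v' hw => ?_⟩
    rw [h2, chosen_eq ((nAdmissible_resolveN hu).1 hw).2]
  · obtain ⟨k', h1, h2⟩ := stage2 nf k hN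
    exact ⟨nf, k', h1, hN, fun w => ⟨fun h => ⟨h, fun j Y hj => (hN ⟨j, Y, hj⟩).elim⟩, And.left⟩,
      fun w v' _ => h2 w v'⟩

theorem BStep.exists_taus {E : Defn S} {P P' : Term S T} {e : Event S T} (h : BStep E P e P') :
    ∃ Q, Taus E P Q ∧ Step E Q (some e) P' := by
  induction h with
  | @pre c tf nf k v v' w hw ht =>
    obtain ⟨nf', k', h1, h2, h3, h4⟩ := exists_taus_pre (E := E) tf nf k w v hw.nd_mem
    have hw' : NAdmissible nf' w := (h3 w).2 ⟨hw, fun _ _ _ => rfl⟩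
    refine ⟨_, h1, ?_⟩
    rw [← h4 w v' hw', ← bindings_congr (fun i x => resolveT_eq_inp (tf := tf) (v := v)) v']
    exact Step.comm v' w h2 ht hw'
  | extL _ ih =>
    obtain ⟨Q, h1, h2⟩ := ih
    exact ⟨_, h1.map (Term.ext · _) (fun _ _ => Step.extTauL), .extL h2⟩
  | extR _ ih =>
    obtain ⟨Q, h1, h2⟩ := ih
    exact ⟨_, h1.map (Term.ext _ ·) (fun _ _ => Step.extTauR), .extR h2⟩
  | intL _ ih =>
    obtain ⟨Q, h1, h2⟩ := ih
    exact ⟨_, .head Step.intL h1, h2⟩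
  | intR _ ih =>
    obtain ⟨Q, h1, h2⟩ := ih
    exact ⟨_, .head Step.intR h1, h2⟩
  | slideL _ ih =>
    obtain ⟨Q, h1, h2⟩ := ih
    exact ⟨_, h1.map (Term.slide · _) (fun _ _ => Step.slideTau), .slideVis h2⟩
  | slideR _ ih =>
    obtain ⟨Q, h1, h2⟩ := ih
    exact ⟨_, .head Step.slideOut h1, h2⟩
  | ifNTrue _ ih =>
    obtain ⟨Q, h1, h2⟩ := ih
    exact h1.lift (fun _ _ => Step.ifNTrue) h2
  | ifNFalse _ ih =>
    obtain ⟨Q, h1, h2⟩ := ih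
    exact h1.lift (fun _ _ => Step.ifNFalse) h2
  | ifTTrue hc hg _ ih =>
    obtain ⟨Q, h1, h2⟩ := ih
    exact h1.lift (fun _ _ => Step.ifTTrue hc hg) h2
  | ifTFalse hc hg _ ih =>
    obtain ⟨Q, h1, h2⟩ := ih
    exact h1.lift (fun _ _ => Step.ifTFalse hc hg) h2
  | call _ ih =>
    obtain ⟨Q, h1, h2⟩ := ih
    exact ⟨_, .head Step.call h1, h2⟩

/-- The state `Q` is stable and can perform no event of `X`. -/
def Refusing (E : Defn S) (X : Set (Event S T)) (Q : Term S T) : Prop :=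
  (∀ Q', ¬ Step E Q none Q') ∧ ∀ e ∈ X, ∀ Q', ¬ Step E Q (some e) Q'

theorem exists_refusing_of_steps {E : Defn S} {X : Set (Event S T)} {P R : Term S T}
    (hf : ∀ a A, Step E R a A ↔ Step E P a A) (h : ∃ Q, Taus E P Q ∧ Refusing E X Q) :
    ∃ Q, Taus E R Q ∧ Refusing E X Q := by
  obtain ⟨Q, h1, h2⟩ := h
  rcases Relation.ReflTransGen.cases_head h1 with rfl | ⟨Q', hq, hQ⟩
  · exact ⟨R, .refl, fun Q' => by simpa [hf] using h2.1 Q', fun e he Q' => by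
      simpa [hf] using h2.2 e he Q'⟩
  · exact ⟨Q, .head ((hf _ _).2 hq) hQ, h2⟩

theorem Fail.exists_taus [Nonempty T] {E : Defn S} {X : Set (Event S T)} {P : Term S T}
    (h : Fail E X P) : ∃ Q, Taus E P Q ∧ Refusing E X Q := by
  have stable_pre : ∀ {c : S.Chan} {tf : TPos S c → TField S T} {nf : NPos S c → NField S c}
      {k : (NPos S c → S.Val) → Term S T}, ¬ HasNdN nf → ¬ HasNdT tf →
      (∀ v w, NAdmissible nf w → TComms tf v → (⟨c, v, w⟩ : Event S T) ∉ X) →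
      Refusing E X (.pre c tf nf k) := by
    intro c tf nf k hN hT hX
    refine ⟨fun Q' hs => ?_, fun e he Q' hs => ?_⟩
    · cases hs with
      | selN _ h => exact hN h
      | selT _ _ h => exact hT h
    · cases hs with
      | comm v w _ ht hw => exact hX v w hw ht he
  induction h with
  | deadlock => exact ⟨_, .refl, fun _ hs => (by cases hs), fun _ _ _ hs => (by cases hs)⟩
  | @stuck c tf nf k hu =>
    have hw : ∀ w, ¬ NAdmissible nf w := fun w hw => hu ⟨w, hw.nd_mem⟩
    by_cases hN : HasNdN nf
    · refine ⟨_, .refl, fun Q' hs => ?_, fun e he Q' hs => ?_⟩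
      · cases hs with
        | selN v _ h => exact hu ⟨v, h⟩
        | selT _ h => exact h hN
      · cases hs with
        | comm v w h => exact h hN
    -- Without a selection, `hu` can only hold because there is no tuple of values at all, and then
    -- no event is possible either.
    · let v : TPos S c → T := fun _ => Classical.arbitrary T
      by_cases hT : HasNdT tf
      · exact ⟨_, .single (Step.selT v hN hT), stable_pre hN (not_hasNdT_resolveT tf v)
          fun _ w h => (hw w h).elim⟩
      · exact ⟨_, .refl, stable_pre hN hT fun _ w h => (hw w h).elim⟩
  | @pre c tf nf k u v hu hX =>
    obtain ⟨nf', k', h1, h2, h3, -⟩ := exists_taus_pre (E := E) tf nf k u v hu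
    refine ⟨_, h1, stable_pre h2 (not_hasNdT_resolveT tf v) fun v' w hw ht => ?_⟩
    exact hX v' w ((h3 w).1 hw).1 ((h3 w).1 hw).2 ht
  | @ext P Q _ _ ih1 ih2 =>
    obtain ⟨P', h1, h1', h1''⟩ := ih1
    obtain ⟨Q', h2, h2', h2''⟩ := ih2
    refine ⟨.ext P' Q', (h1.map (Term.ext · Q) (fun _ _ => Step.extTauL)).trans
      (h2.map (Term.ext P' ·) (fun _ _ => Step.extTauR)), fun R hs => ?_, fun e he R hs => ?_⟩
    · cases hs with
      | extTauL h => exact h1' _ h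
      | extTauR h => exact h2' _ h
    · cases hs with
      | extL h => exact h1'' _ he _ h
      | extR h => exact h2'' _ he _ h
  | intL _ ih =>
    obtain ⟨Q, h1, h2⟩ := ih
    exact ⟨_, .head Step.intL h1, h2⟩
  | intR _ ih =>
    obtain ⟨Q, h1, h2⟩ := ih
    exact ⟨_, .head Step.intR h1, h2⟩
  | slide _ ih =>
    obtain ⟨Q, h1, h2⟩ := ih
    exact ⟨_, .head Step.slideOut h1, h2⟩
  | ifNTrue _ ih =>
    exact exists_refusing_of_steps (fun a A => ⟨fun h => by cases h; assumption, .ifNTrue⟩) ih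
  | ifNFalse _ ih =>
    exact exists_refusing_of_steps (fun a A => ⟨fun h => by cases h; assumption, .ifNFalse⟩) ih
  | ifTTrue hc hg _ ih =>
    refine exists_refusing_of_steps (fun a A => ⟨fun h => ?_, .ifTTrue hc hg⟩) ih
    cases h with
    | ifTTrue _ _ h => exact h
    | ifTFalse _ h => exact (h hg).elim
  | ifTFalse hc hg _ ih =>
    refine exists_refusing_of_steps (fun a A => ⟨fun h => ?_, .ifTFalse hc hg⟩) ih
    cases h with
    | ifTTrue _ h => exact (hg h).elim
    | ifTFalse _ _ h => exact h
  | ifTOpen hc =>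
    refine ⟨_, .refl, fun Q' hs => ?_, fun e he Q' hs => ?_⟩ <;>
    · cases hs <;> exact hc ‹_›
  | call _ ih =>
    obtain ⟨Q, h1, h2⟩ := ih
    exact ⟨_, .head Step.call h1, h2⟩

/-- A structural induction suffices: internal choices, sliding choices and identifiers always have
an internal step, so stability rules them out, and every other operator passes stability on to the
arguments that matter. -/
theorem Fail.of_refusing [Nonempty T] {E : Defn S} {X : Set (Event S T)} {P : Term S T}
    (h : Refusing E X P) : Fail E X P := by
  induction P with
  | STOP => exact .deadlock
  | pre c tf nf k _ =>
    by_cases hu : ∃ u : NPos S c → S.Val, ∀ j Y, nf j = .nd Y → u j ∈ Y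
    · obtain ⟨u, hu⟩ := hu
      have hN : ¬ HasNdN nf := fun hN => h.1 _ (.selN u hN hu)
      have hT : ¬ HasNdT tf := fun hT => h.1 _ (.selT (fun _ => Classical.arbitrary T) hN hT)
      refine .pre u (fun _ => Classical.arbitrary T) hu fun v' w hw _ ht hX => ?_
      rw [resolveT_of_not_hasNdT hT] at ht
      exact h.2 _ hX _ (.comm v' w hN ht hw)
    · exact .stuck hu
  | ext P Q ihP ihQ =>
    exact .ext (ihP ⟨fun Q' hs => h.1 _ (.extTauL hs), fun e he Q' hs => h.2 e he _ (.extL hs)⟩)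
      (ihQ ⟨fun Q' hs => h.1 _ (.extTauR hs), fun e he Q' hs => h.2 e he _ (.extR hs)⟩)
  | int P Q => exact (h.1 _ .intL).elim
  | slide P Q => exact (h.1 _ .slideOut).elim
  | ifN b P Q ihP ihQ =>
    cases b with
    | true =>
      exact .ifNTrue (ihP ⟨fun Q' hs => h.1 _ (.ifNTrue hs),
        fun e he Q' hs => h.2 e he _ (.ifNTrue hs)⟩)
    | false =>
      exact .ifNFalse (ihQ ⟨fun Q' hs => h.1 _ (.ifNFalse hs),
        fun e he Q' hs => h.2 e he _ (.ifNFalse hs)⟩)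
  | ifT g P Q ihP ihQ =>
    by_cases hc : g.Closed
    · by_cases hg : g.Holds
      · exact .ifTTrue hc hg (ihP ⟨fun Q' hs => h.1 _ (.ifTTrue hc hg hs),
          fun e he Q' hs => h.2 e he _ (.ifTTrue hc hg hs)⟩)
      · exact .ifTFalse hc hg (ihQ ⟨fun Q' hs => h.1 _ (.ifTFalse hc hg hs),
          fun e he Q' hs => h.2 e he _ (.ifTFalse hc hg hs)⟩)
    · exact .ifTOpen hc
  | call Y Γ => exact (h.1 _ .call).elim

/-! ## Weak paths -/

theorem Path.append {St : Type v} {L : Type u} {tr : St → L → St → Prop} {p q r : St}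
    {s t : List L} (h : Path tr p s q) (h' : Path tr q t r) : Path tr p (s ++ t) r := by
  induction h with
  | nil => exact h'
  | cons h1 _ ih => exact .cons h1 (ih h')

theorem Taus.exists_path {E : Defn S} {P Q : Term S T} (h : Taus E P Q) :
    ∃ s, Path (Step E) P s Q ∧ s.reduceOption = [] := by
  induction h with
  | refl => exact ⟨[], .nil _, rfl⟩
  | tail _ hs ih =>
    obtain ⟨s, h1, h2⟩ := ih
    exact ⟨s ++ [none], h1.append (.cons hs (.nil _)), by simp [List.reduceOption_append, h2]⟩

theorem weakPath_of_path {E : Defn S} {R P Q Q' : Term S T} {t : List (Event S T)}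
    (h : Path (BStep E) P t Q) (hQ : Taus E Q Q') : (R.lts E).WeakPath P t Q' := by
  induction h with
  | nil p =>
    obtain ⟨s, h1, h2⟩ := hQ.exists_path
    exact ⟨s, h1, h2⟩
  | cons h1 _ ih =>
    obtain ⟨s, h2, h3⟩ := ih hQ
    obtain ⟨P1, h4, h5⟩ := h1.exists_taus
    obtain ⟨s', h6, h7⟩ := h4.exists_path
    exact ⟨s' ++ some _ :: s, h6.append (.cons h5 h2), by
      simp [List.reduceOption_append, h3, h7, List.reduceOption_cons_of_some]⟩

/-- Induction from the front of the path: a leading internal step is absorbed by the next big step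
if there is one, and otherwise joins the trailing internal steps. -/
theorem exists_path_of_weakPath {E : Defn S} {R P Q : Term S T} {t : List (Event S T)}
    (h : (R.lts E).WeakPath P t Q) : ∃ Q', Path (BStep E) P t Q' ∧ Taus E Q' Q := by
  obtain ⟨s, h, rfl⟩ := h
  change Path (Step E) P s Q at h
  induction h with
  | nil p => exact ⟨p, .nil p, .refl⟩
  | @cons p q r a s h1 _ ih =>
    obtain ⟨Q', h2, h3⟩ := ih
    cases a with
    | none =>
      simp only [List.reduceOption_cons_of_none]
      generalize s.reduceOption = t at h2
      cases h2 with
      | nil => exact ⟨p, .nil p, .head h1 h3⟩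
      | cons h4 h5 => exact ⟨Q', .cons (.of_tau h1 h4) h5, h3⟩
    | some e =>
      simp only [List.reduceOption_cons_of_some]
      exact ⟨Q', .cons (.of_step h1) h2, h3⟩

theorem mem_traces_lts {E : Defn S} {P : Term S T} {t : List (Event S T)} :
    t ∈ (P.lts E).traces ↔ ∃ Q, Path (BStep E) P t Q := by
  constructor
  · rintro ⟨Q, h⟩
    obtain ⟨Q', h, -⟩ := exists_path_of_weakPath h
    exact ⟨Q', h⟩
  · rintro ⟨Q, h⟩
    exact ⟨Q, weakPath_of_path h .refl⟩

theorem mem_failures_lts [Nonempty T] {E : Defn S} {P : Term S T} {t : List (Event S T)}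
    {X : Set (Event S T)} :
    (t, X) ∈ (P.lts E).failures ↔ ∃ Q, Path (BStep E) P t Q ∧ Fail E X Q := by
  constructor
  · rintro ⟨Q, h, hr⟩
    obtain ⟨Q', h, hQ⟩ := exists_path_of_weakPath h
    refine ⟨Q', h, ?_⟩
    clear h
    induction hQ using Relation.ReflTransGen.head_induction_on with
    | refl => exact .of_refusing hr
    | head h _ ih => exact .of_tau h ih
  · rintro ⟨Q, h, hf⟩
    obtain ⟨Q', h1, h2⟩ := hf.exists_taus
    exact ⟨Q', weakPath_of_path h h1, h2⟩

/-! ## Convergence -/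

/-- Convergent terms: the resolution of the initial conditionals and identifiers ends. -/
inductive Conv (E : Defn S) : Term S T → Prop
  | deadlock : Conv E .STOP
  | pre {c : S.Chan} {tf : TPos S c → TField S T} {nf : NPos S c → NField S c}
      {k : (NPos S c → S.Val) → Term S T} : Conv E (.pre c tf nf k)
  | ext {P Q : Term S T} : Conv E P → Conv E Q → Conv E (.ext P Q)
  | int {P Q : Term S T} : Conv E P → Conv E Q → Conv E (.int P Q)
  | slide {P Q : Term S T} : Conv E P → Conv E Q → Conv E (.slide P Q)
  | ifNTrue {P Q : Term S T} : Conv E P → Conv E (.ifN true P Q)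
  | ifNFalse {P Q : Term S T} : Conv E Q → Conv E (.ifN false P Q)
  | ifTTrue {g : Guard S T} {P Q : Term S T} :
      g.Closed → g.Holds → Conv E P → Conv E (.ifT g P Q)
  | ifTFalse {g : Guard S T} {P Q : Term S T} :
      g.Closed → ¬ g.Holds → Conv E Q → Conv E (.ifT g P Q)
  | ifTOpen {g : Guard S T} {P Q : Term S T} : ¬ g.Closed → Conv E (.ifT g P Q)
  | call {Y : S.Ident} {Γ : S.Var → Option T} : Conv E ((E Y).inst Γ) → Conv E (.call Y Γ)

/-- Read contrapositively, a term that is not convergent has an internal step to another such term;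
iterating this yields a divergence. Choices pass to their arguments structurally, and identifiers
unfold by an internal step. -/
theorem Conv.of_tau {E : Defn S} {P : Term S T} (h : ∀ Q, Tau E P Q → Conv E Q) : Conv E P := by
  induction P with
  | STOP => exact .deadlock
  | pre => exact .pre
  | ext P Q ihP ihQ =>
    refine .ext (ihP fun P' hs => ?_) (ihQ fun Q' hs => ?_)
    · cases h _ (Step.extTauL hs)
      assumption
    · cases h _ (Step.extTauR hs)
      assumption
  | int P Q => exact .int (h _ .intL) (h _ .intR)
  | slide P Q ihP ihQ =>
    refine .slide (ihP fun P' hs => ?_) (h _ .slideOut)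
    cases h _ (Step.slideTau hs)
    assumption
  | ifN b P Q ihP ihQ =>
    cases b with
    | true => exact .ifNTrue (ihP fun P' hs => h _ (.ifNTrue hs))
    | false => exact .ifNFalse (ihQ fun P' hs => h _ (.ifNFalse hs))
  | ifT g P Q ihP ihQ =>
    by_cases hc : g.Closed
    · by_cases hg : g.Holds
      · exact .ifTTrue hc hg (ihP fun P' hs => h _ (.ifTTrue hc hg hs))
      · exact .ifTFalse hc hg (ihQ fun P' hs => h _ (.ifTFalse hc hg hs))
    · exact .ifTOpen hc
  | call Y Γ => exact .call (h _ .call)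

/-- A reachable state of a divergence-free process is convergent. -/
theorem conv_of_divergenceFree {E : Defn S} {P Q : Term S T} {t : List (Event S T)}
    (hd : (P.lts E).DivergenceFree) (h : Path (BStep E) P t Q) : Conv E Q := by
  by_contra hQ
  -- Working in the subtype of non-convergent terms lets the successor function be iterated.
  have hnext : ∀ R : {R : Term S T // ¬ Conv E R},
      ∃ R' : {R : Term S T // ¬ Conv E R}, Tau E R.1 R'.1 := by
    rintro ⟨R, hR⟩
    by_contra hno
    push Not at hno
    exact hR (.of_tau fun Q hQ => by_contra fun hc => hno ⟨Q, hc⟩ hQ)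
  choose f hf using hnext
  refine hd ⟨t, fun i => (f^[i] ⟨Q, hQ⟩).1, weakPath_of_path h .refl, fun i => ?_⟩
  change Tau E (f^[i] ⟨Q, hQ⟩).1 (f^[i + 1] ⟨Q, hQ⟩).1
  rw [Function.iterate_succ_apply']
  exact hf _

/-! ## Process syntaxes with valuations of the variables of type `t` -/

/-- The truth value of a condition in a valuation of the variables. -/
def Guard.Eval (γ : S.Var → T) (g : Guard S Empty) : Prop :=
  ((g.embed : Guard S T).subst (fun x => some (γ x))).Holds

theorem Atom.subst_embed_congr {Γ Δ : S.Var → Option T} {a : Atom S Empty}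
    (h : ∀ x, a = .inl x → Γ x = Δ x) :
    Atom.subst Γ (Atom.embed a : Atom S T) = Atom.subst Δ (Atom.embed a) := by
  rcases a with x | v
  · simp [Atom.embed, Atom.subst, h x rfl]
  · exact v.elim

theorem Guard.subst_embed_congr {Γ Δ : S.Var → Option T} {g : Guard S Empty}
    (h : ∀ x, g.Mentions x → Γ x = Δ x) :
    (g.embed : Guard S T).subst Γ = (g.embed : Guard S T).subst Δ := by
  induction g with
  | eq a b =>
    simp only [Guard.embed, Guard.subst]
    rw [Atom.subst_embed_congr fun x hx => h x (Or.inl hx),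
      Atom.subst_embed_congr fun x hx => h x (Or.inr hx)]
  | not g ih =>
    simp only [Guard.embed, Guard.subst]
    rw [ih h]
  | and g₁ g₂ ih₁ ih₂ =>
    simp only [Guard.embed, Guard.subst]
    rw [ih₁ fun x hx => h x (Or.inl hx), ih₂ fun x hx => h x (Or.inr hx)]
  | or g₁ g₂ ih₁ ih₂ =>
    simp only [Guard.embed, Guard.subst]
    rw [ih₁ fun x hx => h x (Or.inl hx), ih₂ fun x hx => h x (Or.inr hx)]

theorem Guard.closed_subst_some (γ : S.Var → T) (g : Guard S Empty) :
    ((g.embed : Guard S T).subst (fun x => some (γ x))).Closed := by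
  have key : ∀ a : Atom S Empty,
      ∃ v, Atom.subst (fun x => some (γ x)) (Atom.embed a : Atom S T) = .inr v := by
    rintro (x | v)
    · exact ⟨γ x, rfl⟩
    · exact v.elim
  induction g with
  | eq a b => exact ⟨key a, key b⟩
  | not g ih => exact ih
  | and g₁ g₂ ih₁ ih₂ => exact ⟨ih₁, ih₂⟩
  | or g₁ g₂ ih₁ ih₂ => exact ⟨ih₁, ih₂⟩

/-- Maps preserve equalities. The converse fails for non-injective maps, which is the case that the
refinement between the two branches of a conditional takes care of. -/
theorem Guard.PosConj.eval_comp {T' : Type} {g : Guard S Empty} (hg : g.PosConj) {γ : S.Var → T}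
    (ψ : T → T') (h : g.Eval γ) : g.Eval (ψ ∘ γ) := by
  induction g with
  | eq a b =>
    rcases a with x | v
    · rcases b with y | v
      · simp only [Guard.Eval, Guard.embed, Guard.subst, Guard.Holds, Atom.embed, Atom.subst,
          Sum.map_inl, id, Sum.inr.injEq] at h ⊢
        simp [h]
      · exact v.elim
    · exact v.elim
  | not g => exact hg.elim
  | or => exact hg.elim
  | and g₁ g₂ ih₁ ih₂ => exact ⟨ih₁ hg.1 h.1, ih₂ hg.2 h.2⟩

/-- The values at the positions of the outputs of type `t` are those of the variables. -/
def TMatch {c : S.Chan} (γ : S.Var → T) (tf : TPos S c → TField S Empty) (v : TPos S c → T) : Prop :=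
  ∀ i x, tf i = .out (.inl x) → v i = γ x

open Classical in
/-- The valuation after a construct with fields `tf` has communicated the values `v`. -/
noncomputable def upd {c : S.Chan} (γ : S.Var → T) (tf : TPos S c → TField S Empty)
    (v : TPos S c → T) : S.Var → T := fun x =>
  if h : ∃ i, tf i = .nd x ∨ tf i = .inp x then v h.choose else γ x

/-- The position chosen in `upd` depends only on `tf`, so mapping values commutes with updating. -/
theorem comp_upd {T' : Type} (ψ : T → T') {c : S.Chan} (γ : S.Var → T)
    (tf : TPos S c → TField S Empty) (v : TPos S c → T) :
    ψ ∘ upd γ tf v = upd (ψ ∘ γ) tf (ψ ∘ v) := by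
  funext x
  simp only [upd, Function.comp]
  split_ifs <;> rfl

/-- `Init E γ P R`: `R` is an initial construct of `P`, in a branch selected by the values of the
conditions. -/
inductive Init (E : Defn S) (γ : S.Var → T) : Syn S → Syn S → Prop
  | pre (c : S.Chan) (tf : TPos S c → TField S Empty) (nf : NPos S c → NField S c)
      (k : (NPos S c → S.Val) → Syn S) : Init E γ (.pre c tf nf k) (.pre c tf nf k)
  | extL {P Q R : Syn S} : Init E γ P R → Init E γ (.ext P Q) R
  | extR {P Q R : Syn S} : Init E γ Q R → Init E γ (.ext P Q) R
  | intL {P Q R : Syn S} : Init E γ P R → Init E γ (.int P Q) R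
  | intR {P Q R : Syn S} : Init E γ Q R → Init E γ (.int P Q) R
  | slideL {P Q R : Syn S} : Init E γ P R → Init E γ (.slide P Q) R
  | slideR {P Q R : Syn S} : Init E γ Q R → Init E γ (.slide P Q) R
  | ifNTrue {P Q R : Syn S} : Init E γ P R → Init E γ (.ifN true P Q) R
  | ifNFalse {P Q R : Syn S} : Init E γ Q R → Init E γ (.ifN false P Q) R
  | ifTTrue {g : Guard S Empty} {P Q R : Syn S} :
      g.Eval γ → Init E γ P R → Init E γ (.ifT g P Q) R
  | ifTFalse {g : Guard S Empty} {P Q R : Syn S} :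
      ¬ g.Eval γ → Init E γ Q R → Init E γ (.ifT g P Q) R
  | call {X : S.Ident} {Γ : S.Var → Option Empty} {R : Syn S} :
      Init E γ (E X) R → Init E γ (.call X Γ) R

/-- A process syntax together with a valuation of its variables. -/
abbrev Config (S : Sig.{u}) (T : Type) : Type u := Syn S × (S.Var → T)

/-- Visible transitions of process syntaxes with valuations. -/
def CStep (E : Defn S) (p : Config S T) (e : Event S T) (q : Config S T) : Prop :=
  ∃ tf nf k, Init E p.2 p.1 (.pre e.chan tf nf k) ∧ NAdmissible nf e.nval ∧ TMatch p.2 tf e.tval ∧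
    q = (k e.nval, upd p.2 tf e.tval)

/-- `CFail E γ X P`: in the valuation `γ`, `P` has the failure `(⟨⟩, X)`. -/
inductive CFail (E : Defn S) (γ : S.Var → T) (X : Set (Event S T)) : Syn S → Prop
  | deadlock : CFail E γ X .STOP
  | stuck {c : S.Chan} {tf : TPos S c → TField S Empty} {nf : NPos S c → NField S c}
      {k : (NPos S c → S.Val) → Syn S} :
      (¬ ∃ u : NPos S c → S.Val, ∀ j Y, nf j = .nd Y → u j ∈ Y) → CFail E γ X (.pre c tf nf k)
  | pre {c : S.Chan} {tf : TPos S c → TField S Empty} {nf : NPos S c → NField S c}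
      {k : (NPos S c → S.Val) → Syn S} (u : NPos S c → S.Val) (v : TPos S c → T) :
      (∀ j Y, nf j = .nd Y → u j ∈ Y) →
      (∀ v' w, NAdmissible nf w → (∀ j Y, nf j = .nd Y → w j = u j) → TMatch γ tf v' →
        (∀ i x, tf i = .nd x → v' i = v i) → (⟨c, v', w⟩ : Event S T) ∉ X) →
      CFail E γ X (.pre c tf nf k)
  | ext {P Q : Syn S} : CFail E γ X P → CFail E γ X Q → CFail E γ X (.ext P Q)
  | intL {P Q : Syn S} : CFail E γ X P → CFail E γ X (.int P Q)
  | intR {P Q : Syn S} : CFail E γ X Q → CFail E γ X (.int P Q)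
  | slide {P Q : Syn S} : CFail E γ X Q → CFail E γ X (.slide P Q)
  | ifNTrue {P Q : Syn S} : CFail E γ X P → CFail E γ X (.ifN true P Q)
  | ifNFalse {P Q : Syn S} : CFail E γ X Q → CFail E γ X (.ifN false P Q)
  | ifTTrue {g : Guard S Empty} {P Q : Syn S} :
      g.Eval γ → CFail E γ X P → CFail E γ X (.ifT g P Q)
  | ifTFalse {g : Guard S Empty} {P Q : Syn S} :
      ¬ g.Eval γ → CFail E γ X Q → CFail E γ X (.ifT g P Q)
  | call {Y : S.Ident} {Γ : S.Var → Option Empty} : CFail E γ X (E Y) → CFail E γ X (.call Y Γ)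

/-! ## Closure properties of the conditions on process syntaxes -/

theorem Within.trans {E : Defn S} {P Q R : Syn S} (h : Within E P Q) (h' : Within E Q R) :
    Within E P R := by
  induction h with
  | refl => exact h'
  | pre w hw _ ih => exact .pre w hw (ih h')
  | extL _ ih => exact .extL (ih h')
  | extR _ ih => exact .extR (ih h')
  | intL _ ih => exact .intL (ih h')
  | intR _ ih => exact .intR (ih h')
  | slideL _ ih => exact .slideL (ih h')
  | slideR _ ih => exact .slideR (ih h')
  | ifNL _ ih => exact .ifNL (ih h')
  | ifNR _ ih => exact .ifNR (ih h')
  | ifTL _ ih => exact .ifTL (ih h')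
  | ifTR _ ih => exact .ifTR (ih h')
  | call _ ih => exact .call (ih h')

theorem Init.within {E : Defn S} {γ : S.Var → T} {P R : Syn S} (h : Init E γ P R) :
    Within E P R := by
  induction h with
  | pre => exact .refl _
  | extL _ ih => exact .extL ih
  | extR _ ih => exact .extR ih
  | intL _ ih => exact .intL ih
  | intR _ ih => exact .intR ih
  | slideL _ ih => exact .slideL ih
  | slideR _ ih => exact .slideR ih
  | ifNTrue _ ih => exact .ifNL ih
  | ifNFalse _ ih => exact .ifNR ih
  | ifTTrue _ _ ih => exact .ifTL ih
  | ifTFalse _ _ ih => exact .ifTR ih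
  | call _ ih => exact .call ih

theorem Init.initially {E : Defn S} {γ : S.Var → T} {P R : Syn S} (h : Init E γ P R) :
    Initially E P R := by
  induction h with
  | pre => exact .refl _
  | extL _ ih => exact .extL ih
  | extR _ ih => exact .extR ih
  | intL _ ih => exact .intL ih
  | intR _ ih => exact .intR ih
  | slideL _ ih => exact .slideL ih
  | slideR _ ih => exact .slideR ih
  | ifNTrue _ ih => exact .ifNL ih
  | ifNFalse _ ih => exact .ifNR ih
  | ifTTrue _ _ ih => exact .ifTL ih
  | ifTFalse _ _ ih => exact .ifTR ih
  | call _ ih => exact .call ih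

theorem Init.mem_channels {E : Defn S} {γ : S.Var → T} {P : Syn S} {c : S.Chan}
    {tf : TPos S c → TField S Empty} {nf : NPos S c → NField S c} {k : (NPos S c → S.Val) → Syn S}
    (h : Init E γ P (.pre c tf nf k)) : c ∈ channels E P :=
  ⟨tf, nf, k, h.initially⟩

/-- The conditions on a process syntax. -/
structure Regular (E : Defn S) (P : Syn S) : Prop where
  once : ∀ c tf nf k, Within E P (.pre c tf nf k) → ∀ i x, (tf i = .nd x ∨ tf i = .inp x) →
    ∀ j, (tf j = .nd x ∨ tf j = .inp x ∨ tf j = .out (.inl x)) → i = j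
  outputs : ∀ c tf nf k, Within E P (.pre c tf nf k) → ∀ j f, nf j = .out f →
    ∀ w w' : NPos S c → S.Val, (∀ l, (∀ f', nf l ≠ .out f') → w l = w' l) → f w = f w'
  ext_disj : ∀ A B, Within E P (.ext A B) → Disjoint (channels E A) (channels E B)
  int_disj : ∀ A B, Within E P (.int A B) → Disjoint (channels E A) (channels E B)
  slide_disj : ∀ A B, Within E P (.slide A B) → Disjoint (channels E A) (channels E B)
  rev : RevPosConjEqTF E P
  mix : NoMixedConstruct E P

theorem Regular.of_within {E : Defn S} {P Q : Syn S} (h : Regular E P) (hw : Within E P Q) :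
    Regular E Q where
  once c tf nf k hQ := h.once c tf nf k (hw.trans hQ)
  outputs c tf nf k hQ := h.outputs c tf nf k (hw.trans hQ)
  ext_disj A B hQ := h.ext_disj A B (hw.trans hQ)
  int_disj A B hQ := h.int_disj A B (hw.trans hQ)
  slide_disj A B hQ := h.slide_disj A B (hw.trans hQ)
  rev g A B hQ := h.rev g A B (hw.trans hQ)
  mix c tf nf k hQ := h.mix c tf nf k (hw.trans hQ)

theorem Regular.cStep {E : Defn S} {p q : Config S T} {e : Event S T} (h : Regular E p.1)
    (hs : CStep E p e q) : Regular E q.1 := by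
  obtain ⟨tf, nf, k, h1, h2, -, rfl⟩ := hs
  exact h.of_within (h1.within.trans (.pre _ h2 (.refl _)))

theorem Regular.path {E : Defn S} {p q : Config S T} {t : List (Event S T)} (h : Regular E p.1)
    (hs : Path (CStep E) p t q) : Regular E q.1 := by
  induction hs with
  | nil => exact h
  | cons h1 _ ih => exact ih (h.cStep h1)

/-! ## Correspondence with the operational semantics -/

/-- `Γ` substitutes for the free variables of `P` their values in `γ`. -/
def Agree (E : Defn S) (Γ : S.Var → Option T) (γ : S.Var → T) (P : Syn S) : Prop :=
  ∀ x, FreeIn E x P → Γ x = some (γ x)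

theorem bindings_eq_some {c : S.Chan} {b : S.Var → TField S T} {tf : TPos S c → TField S T}
    {v : TPos S c → T} {x : S.Var} {i : TPos S c} (hi : tf i = b x)
    (huniq : ∀ j, tf j = b x → j = i) : bindings b tf v x = some (v i) := by
  have h : ∃ i, tf i = b x := ⟨i, hi⟩
  rw [bindings, dif_pos h, huniq _ h.choose_spec]

theorem upd_eq {c : S.Chan} {γ : S.Var → T} {tf : TPos S c → TField S Empty} {v : TPos S c → T}
    {x : S.Var} {i : TPos S c} (hi : tf i = .nd x ∨ tf i = .inp x)
    (huniq : ∀ j, (tf j = .nd x ∨ tf j = .inp x) → j = i) : upd γ tf v x = v i := by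
  have h : ∃ i, tf i = .nd x ∨ tf i = .inp x := ⟨i, hi⟩
  rw [upd, dif_pos h, huniq _ h.choose_spec]

/-- The fields of a construct after substitution. -/
def fieldsInst {c : S.Chan} (tf : TPos S c → TField S Empty) (Γ : S.Var → Option T) :
    TPos S c → TField S T :=
  fun i => (tf i).embed.subst Γ

theorem fieldsInst_eq_nd {c : S.Chan} {tf : TPos S c → TField S Empty} {Γ : S.Var → Option T}
    {i : TPos S c} {x : S.Var} : fieldsInst tf Γ i = .nd x ↔ tf i = .nd x := by
  simp [fieldsInst, TField.subst_eq_nd, TField.embed_eq_nd]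

theorem fieldsInst_eq_inp {c : S.Chan} {tf : TPos S c → TField S Empty} {Γ : S.Var → Option T}
    {i : TPos S c} {x : S.Var} : fieldsInst tf Γ i = .inp x ↔ tf i = .inp x := by
  simp [fieldsInst, TField.subst_eq_inp, TField.embed_eq_inp]

/-- The variables bound by a construct are pairwise distinct. -/
def Once {c : S.Chan} (tf : TPos S c → TField S Empty) : Prop :=
  ∀ i x, (tf i = .nd x ∨ tf i = .inp x) →
    ∀ j, (tf j = .nd x ∨ tf j = .inp x ∨ tf j = .out (.inl x)) → i = j

/-- Since each bound variable has a single position, the choice inside `bindings` finds that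
position. Selections thus become outputs of the values in `v`, output variables take their values in
`γ`, and inputs remain unconstrained. -/
theorem tComms_resolveT_fieldsInst {c : S.Chan} {tf : TPos S c → TField S Empty} (ho : Once tf)
    {Γ : S.Var → Option T} {γ : S.Var → T}
    (hΓ : ∀ i x, tf i = .out (.inl x) → Γ x = some (γ x)) (v v' : TPos S c → T) :
    TComms (resolveT (fieldsInst tf Γ) v) v' ↔
      TMatch γ tf v' ∧ ∀ i x, tf i = .nd x → v' i = v i := by
  have hnd : ∀ i x, tf i = .nd x →
      (resolveT (fieldsInst tf Γ) v i = .out (.inr (v i))) := by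
    intro i x hi
    have hb : bindings .nd (fieldsInst tf Γ) v x = some (v i) :=
      bindings_eq_some (fieldsInst_eq_nd.2 hi) fun j hj =>
        (ho i x (.inl hi) j (.inl (fieldsInst_eq_nd.1 hj))).symm
    simp [resolveT, replaceT, fieldsInst_eq_nd.2 hi, TField.subst, Atom.subst, hb]
  have hout : ∀ i x, tf i = .out (.inl x) →
      (resolveT (fieldsInst tf Γ) v i = .out (.inr (γ x))) := by
    intro i x hi
    have : fieldsInst tf Γ i = .out (.inr (γ x)) := by
      simp [fieldsInst, hi, TField.embed, TField.subst, Atom.subst, Atom.embed, hΓ i x hi]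
    simp [resolveT, replaceT, this, TField.subst, Atom.subst]
  constructor
  · intro h
    refine ⟨fun i x hi => ?_, fun i x hi => ?_⟩
    · have := h i
      simp only [hout i x hi, Sum.inr.injEq] at this
      exact this.symm
    · have := h i
      simp only [hnd i x hi, Sum.inr.injEq] at this
      exact this.symm
  · rintro ⟨h1, h2⟩ i
    cases hi : tf i with
    | nd x => simp [hnd i x hi, h2 i x hi]
    | inp x => simp [resolveT_eq_inp.2 (fieldsInst_eq_inp.2 hi)]
    | out a =>
      rcases a with x | a
      · simp [hout i x hi, h1 i x hi]
      · exact a.elim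

/-- Three successive substitutions (outer values, selections, inputs) compose to a single one. A
selection variable is bound by `tf` but no longer by `replaceT`, so the second substitution supplies
its value; an input variable is shielded from the first two and gets its value from the third; any
other free variable keeps its value in `γ`. -/
theorem exists_contT_inst {E : Defn S} {c : S.Chan} {tf : TPos S c → TField S Empty}
    {nf : NPos S c → NField S c} {k : (NPos S c → S.Val) → Syn S} (ho : Once tf)
    {Γ : S.Var → Option T} {γ : S.Var → T} (hΓ : Agree E Γ γ (.pre c tf nf k))
    {v v' : TPos S c → T} {w : NPos S c → S.Val} (hw : NAdmissible nf w)
    (hv : ∀ i x, tf i = .nd x → v' i = v i) :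
    ∃ Γ', contT (fieldsInst tf Γ) v v' ((k w).embed.subst (open Classical in
        fun x => if Binds (fun i => ((tf i).embed : TField S T)) x then none else Γ x)) = (k w).inst Γ' ∧
      Agree E Γ' (upd γ tf v') (k w) := by
  refine ⟨_, by rw [contT, Term.subst_subst, Term.subst_subst, Term.inst], fun x hx => ?_⟩
  by_cases hb : ∃ i, tf i = .nd x ∨ tf i = .inp x
  · obtain ⟨i, hi⟩ := hb
    have hB : Binds (fun i => ((tf i).embed : TField S T)) x := binds_embed.2 ⟨i, hi⟩
    have huniq : ∀ j, (tf j = .nd x ∨ tf j = .inp x) → j = i := fun j hj =>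
      (ho i x hi j (hj.imp_right .inl)).symm
    rw [upd_eq hi huniq]
    simp only [hB, if_true, Option.none_or]
    rcases hi with hi | hi
    · have hB' : ¬ Binds (replaceT (fieldsInst tf Γ)) x := by
        rintro ⟨j, hj | hj⟩
        · exact replaceT_ne_nd _ _ _ hj
        · have hj := fieldsInst_eq_inp.1 (replaceT_eq_inp.1 hj)
          rw [huniq j (.inr hj), hi] at hj
          cases hj
      have hb : bindings .nd (fieldsInst tf Γ) v x = some (v i) :=
        bindings_eq_some (fieldsInst_eq_nd.2 hi) fun j hj => huniq j (.inl (fieldsInst_eq_nd.1 hj))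
      simp [hB', hb, hv i x hi]
    · have hB' : Binds (replaceT (fieldsInst tf Γ)) x :=
        ⟨i, .inr (replaceT_eq_inp.2 (fieldsInst_eq_inp.2 hi))⟩
      have hb : bindings .inp (fieldsInst tf Γ) v' x = some (v' i) :=
        bindings_eq_some (fieldsInst_eq_inp.2 hi) fun j hj =>
          huniq j (.inr (fieldsInst_eq_inp.1 hj))
      simp [hB', hb]
  · have hB : ¬ Binds (fun i => ((tf i).embed : TField S T)) x := binds_embed.not.2 hb
    have hu : upd γ tf v' x = γ x := by rw [upd, dif_neg hb]
    rw [hu]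
    simp [hB, hΓ x (.cont w hw hb hx)]

theorem Guard.subst_embed_of_agree {E : Defn S} {Γ : S.Var → Option T} {γ : S.Var → T}
    {g : Guard S Empty} {P Q : Syn S} (hΓ : Agree E Γ γ (.ifT g P Q)) :
    (g.embed : Guard S T).subst Γ = g.embed.subst (fun x => some (γ x)) :=
  Guard.subst_embed_congr fun x hx => hΓ x (.ifTCond hx)

/-- Terms reached from `P.inst Γ` are always of the form `Q.inst Γ'` with `Q` a process syntax, so
their runs can be followed on configurations. The substitution only has to agree with the valuation
on free variables; values elsewhere are immaterial. -/
theorem BStep.exists_cStep {E : Defn S} {P : Syn S} {Γ : S.Var → Option T} {γ : S.Var → T}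
    {e : Event S T} {R : Term S T} (hR : Regular E P) (hΓ : Agree E Γ γ P)
    (h : BStep E (P.inst Γ) e R) :
    ∃ q Γ', CStep E (P, γ) e q ∧ R = q.1.inst Γ' ∧ Agree E Γ' q.2 q.1 := by
  have lift : ∀ {P Q : Syn S} {R : Term S T} {e : Event S T},
      (∀ R, Init E γ P R → Init E γ Q R) →
      (∃ q Γ', CStep E (P, γ) e q ∧ R = q.1.inst Γ' ∧ Agree E Γ' q.2 q.1) →
      ∃ q Γ', CStep E (Q, γ) e q ∧ R = q.1.inst Γ' ∧ Agree E Γ' q.2 q.1 := by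
    rintro P Q R e hPQ ⟨q, Γ', ⟨tf, nf, k, h1, h2⟩, h3⟩
    exact ⟨q, Γ', ⟨tf, nf, k, hPQ _ h1, h2⟩, h3⟩
  generalize hs : P.inst Γ = s at h
  induction h generalizing P Γ with
  | pre v v' w hw ht =>
    cases P with
    | pre c tf nf k =>
      cases hs
      have ho : Once _ := hR.once _ _ _ _ (.refl _)
      have ht := (tComms_resolveT_fieldsInst ho (fun i x hi => hΓ x (.out i hi)) v v').1 ht
      obtain ⟨Γ', h1, h2⟩ := exists_contT_inst ho hΓ hw ht.2
      exact ⟨_, Γ', ⟨_, _, _, .pre .., hw, ht.1, rfl⟩, h1, h2⟩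
    | _ => cases hs
  | extL _ ih =>
    cases P with
    | ext P Q =>
      cases hs
      exact lift (fun _ => .extL)
        (ih (hR.of_within (.extL (.refl _))) (fun x hx => hΓ x (.extL hx)) rfl)
    | _ => cases hs
  | extR _ ih =>
    cases P with
    | ext P Q =>
      cases hs
      exact lift (fun _ => .extR)
        (ih (hR.of_within (.extR (.refl _))) (fun x hx => hΓ x (.extR hx)) rfl)
    | _ => cases hs
  | intL _ ih =>
    cases P with
    | int P Q =>
      cases hs
      exact lift (fun _ => .intL)
        (ih (hR.of_within (.intL (.refl _))) (fun x hx => hΓ x (.intL hx)) rfl)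
    | _ => cases hs
  | intR _ ih =>
    cases P with
    | int P Q =>
      cases hs
      exact lift (fun _ => .intR)
        (ih (hR.of_within (.intR (.refl _))) (fun x hx => hΓ x (.intR hx)) rfl)
    | _ => cases hs
  | slideL _ ih =>
    cases P with
    | slide P Q =>
      cases hs
      exact lift (fun _ => .slideL)
        (ih (hR.of_within (.slideL (.refl _))) (fun x hx => hΓ x (.slideL hx)) rfl)
    | _ => cases hs
  | slideR _ ih =>
    cases P with
    | slide P Q =>
      cases hs
      exact lift (fun _ => .slideR)
        (ih (hR.of_within (.slideR (.refl _))) (fun x hx => hΓ x (.slideR hx)) rfl)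
    | _ => cases hs
  | ifNTrue _ ih =>
    cases P with
    | ifN b P Q =>
      cases hs
      exact lift (fun _ => .ifNTrue)
        (ih (hR.of_within (.ifNL (.refl _))) (fun x hx => hΓ x (.ifNL hx)) rfl)
    | _ => cases hs
  | ifNFalse _ ih =>
    cases P with
    | ifN b P Q =>
      cases hs
      exact lift (fun _ => .ifNFalse)
        (ih (hR.of_within (.ifNR (.refl _))) (fun x hx => hΓ x (.ifNR hx)) rfl)
    | _ => cases hs
  | ifTTrue _ hg _ ih =>
    cases P with
    | ifT g P Q =>
      cases hs
      rw [Guard.subst_embed_of_agree hΓ] at hg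
      exact lift (fun _ => .ifTTrue hg)
        (ih (hR.of_within (.ifTL (.refl _))) (fun x hx => hΓ x (.ifTL hx)) rfl)
    | _ => cases hs
  | ifTFalse _ hg _ ih =>
    cases P with
    | ifT g P Q =>
      cases hs
      rw [Guard.subst_embed_of_agree hΓ] at hg
      exact lift (fun _ => .ifTFalse hg)
        (ih (hR.of_within (.ifTR (.refl _))) (fun x hx => hΓ x (.ifTR hx)) rfl)
    | _ => cases hs
  | call _ ih =>
    cases P with
    | call X Δ =>
      -- An embedded call carries no values, so substitution makes it carry exactly `Γ`, and it
      -- unfolds to the definition instantiated by `Γ`.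
      simp only [Term.inst, Term.embed, Term.subst, Option.none_or, Term.call.injEq] at hs
      obtain ⟨rfl, rfl⟩ := hs
      exact lift (fun _ => .call)
        (ih (hR.of_within (.call (.refl _))) (fun x hx => hΓ x (.call hx)) rfl)
    | _ => cases hs

theorem CStep.exists_bStep {E : Defn S} {P : Syn S} {Γ : S.Var → Option T} {γ : S.Var → T}
    {e : Event S T} {q : Config S T} (hR : Regular E P) (hΓ : Agree E Γ γ P)
    (h : CStep E (P, γ) e q) :
    ∃ Γ', BStep E (P.inst Γ) e (q.1.inst Γ') ∧ Agree E Γ' q.2 q.1 := by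
  obtain ⟨c, v, w⟩ := e
  obtain ⟨tf, nf, k, h1, hw, ht, rfl⟩ := h
  dsimp only at h1 hw ht tf nf k ⊢
  generalize hr : Term.pre c tf nf k = r at h1
  induction h1 with
  | pre c tf' nf' k' =>
    cases hr
    have ho : Once tf := hR.once _ tf nf k (.refl _)
    obtain ⟨Γ', h1, h2⟩ := exists_contT_inst ho hΓ (v := v) hw (fun _ _ _ => rfl)
    refine ⟨Γ', ?_, h2⟩
    rw [← h1]
    exact .pre v v w hw ((tComms_resolveT_fieldsInst ho (fun i x hi => hΓ x (.out i hi)) v v).2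
      ⟨ht, fun _ _ _ => rfl⟩)
  | extL _ ih =>
    obtain ⟨Γ', h1, h2⟩ := ih (hR.of_within (.extL (.refl _))) (fun x hx => hΓ x (.extL hx)) hr
    exact ⟨Γ', .extL h1, h2⟩
  | extR _ ih =>
    obtain ⟨Γ', h1, h2⟩ := ih (hR.of_within (.extR (.refl _))) (fun x hx => hΓ x (.extR hx)) hr
    exact ⟨Γ', .extR h1, h2⟩
  | intL _ ih =>
    obtain ⟨Γ', h1, h2⟩ := ih (hR.of_within (.intL (.refl _))) (fun x hx => hΓ x (.intL hx)) hr
    exact ⟨Γ', .intL h1, h2⟩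
  | intR _ ih =>
    obtain ⟨Γ', h1, h2⟩ := ih (hR.of_within (.intR (.refl _))) (fun x hx => hΓ x (.intR hx)) hr
    exact ⟨Γ', .intR h1, h2⟩
  | slideL _ ih =>
    obtain ⟨Γ', h1, h2⟩ := ih (hR.of_within (.slideL (.refl _)))
      (fun x hx => hΓ x (.slideL hx)) hr
    exact ⟨Γ', .slideL h1, h2⟩
  | slideR _ ih =>
    obtain ⟨Γ', h1, h2⟩ := ih (hR.of_within (.slideR (.refl _)))
      (fun x hx => hΓ x (.slideR hx)) hr
    exact ⟨Γ', .slideR h1, h2⟩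
  | ifNTrue _ ih =>
    obtain ⟨Γ', h1, h2⟩ := ih (hR.of_within (.ifNL (.refl _))) (fun x hx => hΓ x (.ifNL hx)) hr
    exact ⟨Γ', .ifNTrue h1, h2⟩
  | ifNFalse _ ih =>
    obtain ⟨Γ', h1, h2⟩ := ih (hR.of_within (.ifNR (.refl _))) (fun x hx => hΓ x (.ifNR hx)) hr
    exact ⟨Γ', .ifNFalse h1, h2⟩
  | ifTTrue hg _ ih =>
    obtain ⟨Γ', h1, h2⟩ := ih (hR.of_within (.ifTL (.refl _))) (fun x hx => hΓ x (.ifTL hx)) hr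
    have hs := Guard.subst_embed_of_agree hΓ
    exact ⟨Γ', .ifTTrue (hs ▸ Guard.closed_subst_some γ _) (hs ▸ hg) h1, h2⟩
  | ifTFalse hg _ ih =>
    obtain ⟨Γ', h1, h2⟩ := ih (hR.of_within (.ifTR (.refl _))) (fun x hx => hΓ x (.ifTR hx)) hr
    have hs := Guard.subst_embed_of_agree hΓ
    exact ⟨Γ', .ifTFalse (hs ▸ Guard.closed_subst_some γ _) (hs ▸ hg) h1, h2⟩
  | call _ ih =>
    obtain ⟨Γ', h1, h2⟩ := ih (hR.of_within (.call (.refl _))) (fun x hx => hΓ x (.call hx)) hr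
    refine ⟨Γ', ?_, h2⟩
    simp only [Term.inst, Term.embed, Term.subst, Option.none_or]
    exact .call h1

theorem CFail.fail {E : Defn S} {P : Syn S} {Γ : S.Var → Option T} {γ : S.Var → T}
    {X : Set (Event S T)} (hR : Regular E P) (hΓ : Agree E Γ γ P) (h : CFail E γ X P) :
    Fail E X (P.inst Γ) := by
  induction h with
  | deadlock => exact .deadlock
  | stuck h => exact .stuck h
  | @pre c tf nf k u v hu hX =>
    refine .pre u v hu fun v' w hw hwu ht => ?_
    have ht := (tComms_resolveT_fieldsInst (hR.once c tf nf k (.refl _))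
      (fun i x hi => hΓ x (.out i hi)) v v').1 ht
    exact hX v' w hw hwu ht.1 ht.2
  | ext _ _ ih1 ih2 =>
    exact .ext (ih1 (hR.of_within (.extL (.refl _))) (fun x hx => hΓ x (.extL hx)))
      (ih2 (hR.of_within (.extR (.refl _))) (fun x hx => hΓ x (.extR hx)))
  | intL _ ih =>
    exact .intL (ih (hR.of_within (.intL (.refl _))) (fun x hx => hΓ x (.intL hx)))
  | intR _ ih =>
    exact .intR (ih (hR.of_within (.intR (.refl _))) (fun x hx => hΓ x (.intR hx)))
  | slide _ ih =>
    exact .slide (ih (hR.of_within (.slideR (.refl _))) (fun x hx => hΓ x (.slideR hx)))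
  | ifNTrue _ ih =>
    exact .ifNTrue (ih (hR.of_within (.ifNL (.refl _))) (fun x hx => hΓ x (.ifNL hx)))
  | ifNFalse _ ih =>
    exact .ifNFalse (ih (hR.of_within (.ifNR (.refl _))) (fun x hx => hΓ x (.ifNR hx)))
  | ifTTrue hg _ ih =>
    have hs := Guard.subst_embed_of_agree hΓ
    exact .ifTTrue (hs ▸ Guard.closed_subst_some γ _) (hs ▸ hg)
      (ih (hR.of_within (.ifTL (.refl _))) (fun x hx => hΓ x (.ifTL hx)))
  | ifTFalse hg _ ih =>
    have hs := Guard.subst_embed_of_agree hΓ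
    exact .ifTFalse (hs ▸ Guard.closed_subst_some γ _) (hs ▸ hg)
      (ih (hR.of_within (.ifTR (.refl _))) (fun x hx => hΓ x (.ifTR hx)))
  | call _ ih =>
    simp only [Term.inst, Term.embed, Term.subst, Option.none_or]
    exact .call (ih (hR.of_within (.call (.refl _))) (fun x hx => hΓ x (.call hx)))

theorem Fail.cFail {E : Defn S} {P : Syn S} {Γ : S.Var → Option T} {γ : S.Var → T}
    {X : Set (Event S T)} (hR : Regular E P) (hΓ : Agree E Γ γ P) (h : Fail E X (P.inst Γ)) :
    CFail E γ X P := by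
  generalize hs : P.inst Γ = s at h
  induction h generalizing P Γ with
  | deadlock =>
    cases P with
    | STOP => exact .deadlock
    | _ => cases hs
  | stuck h =>
    cases P with
    | pre c tf nf k =>
      cases hs
      exact .stuck h
    | _ => cases hs
  | pre u v hu hX =>
    cases P with
    | pre c tf nf k =>
      cases hs
      refine .pre u v hu fun v' w hw hwu ht hv => hX v' w hw hwu ?_
      exact (tComms_resolveT_fieldsInst (hR.once _ _ _ _ (.refl _))
        (fun i x hi => hΓ x (.out i hi)) v v').2 ⟨ht, hv⟩
    | _ => cases hs
  | ext _ _ ih1 ih2 =>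
    cases P with
    | ext P Q =>
      cases hs
      exact .ext (ih1 (hR.of_within (.extL (.refl _))) (fun x hx => hΓ x (.extL hx)) rfl)
        (ih2 (hR.of_within (.extR (.refl _))) (fun x hx => hΓ x (.extR hx)) rfl)
    | _ => cases hs
  | intL _ ih =>
    cases P with
    | int P Q =>
      cases hs
      exact .intL (ih (hR.of_within (.intL (.refl _))) (fun x hx => hΓ x (.intL hx)) rfl)
    | _ => cases hs
  | intR _ ih =>
    cases P with
    | int P Q =>
      cases hs
      exact .intR (ih (hR.of_within (.intR (.refl _))) (fun x hx => hΓ x (.intR hx)) rfl)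
    | _ => cases hs
  | slide _ ih =>
    cases P with
    | slide P Q =>
      cases hs
      exact .slide (ih (hR.of_within (.slideR (.refl _))) (fun x hx => hΓ x (.slideR hx)) rfl)
    | _ => cases hs
  | ifNTrue _ ih =>
    cases P with
    | ifN b P Q =>
      cases hs
      exact .ifNTrue (ih (hR.of_within (.ifNL (.refl _))) (fun x hx => hΓ x (.ifNL hx)) rfl)
    | _ => cases hs
  | ifNFalse _ ih =>
    cases P with
    | ifN b P Q =>
      cases hs
      exact .ifNFalse (ih (hR.of_within (.ifNR (.refl _))) (fun x hx => hΓ x (.ifNR hx)) rfl)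
    | _ => cases hs
  | ifTTrue _ hg _ ih =>
    cases P with
    | ifT g P Q =>
      cases hs
      rw [Guard.subst_embed_of_agree hΓ] at hg
      exact .ifTTrue hg (ih (hR.of_within (.ifTL (.refl _))) (fun x hx => hΓ x (.ifTL hx)) rfl)
    | _ => cases hs
  | ifTFalse _ hg _ ih =>
    cases P with
    | ifT g P Q =>
      cases hs
      rw [Guard.subst_embed_of_agree hΓ] at hg
      exact .ifTFalse hg (ih (hR.of_within (.ifTR (.refl _))) (fun x hx => hΓ x (.ifTR hx)) rfl)
    | _ => cases hs
  | ifTOpen hc =>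
    cases P with
    | ifT g P Q =>
      cases hs
      rw [Guard.subst_embed_of_agree hΓ] at hc
      -- A condition blocked by an unsubstituted variable cannot occur, because the valuation is
      -- total.
      exact (hc (Guard.closed_subst_some γ g)).elim
    | _ => cases hs
  | call _ ih =>
    cases P with
    | call X Δ =>
      simp only [Term.inst, Term.embed, Term.subst, Option.none_or, Term.call.injEq] at hs
      obtain ⟨rfl, rfl⟩ := hs
      exact .call (ih (hR.of_within (.call (.refl _))) (fun x hx => hΓ x (.call hx)) rfl)
    | _ => cases hs

theorem exists_path_cStep {E : Defn S} {P : Syn S} {Γ : S.Var → Option T} {γ : S.Var → T}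
    {t : List (Event S T)} {R : Term S T} (hR : Regular E P) (hΓ : Agree E Γ γ P)
    (h : Path (BStep E) (P.inst Γ) t R) :
    ∃ q Γ', Path (CStep E) (P, γ) t q ∧ R = q.1.inst Γ' ∧ Agree E Γ' q.2 q.1 := by
  generalize hs : P.inst Γ = s at h
  induction h generalizing P Γ γ with
  | nil => exact ⟨(P, γ), Γ, .nil _, hs.symm, hΓ⟩
  | cons h1 _ ih =>
    subst hs
    obtain ⟨⟨P', γ'⟩, Γ', h2, rfl, h3⟩ := h1.exists_cStep hR hΓ
    obtain ⟨q, Γ'', h4, h5⟩ := ih (hR.cStep h2) h3 rfl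
    exact ⟨q, Γ'', .cons h2 h4, h5⟩

theorem exists_path_bStep {E : Defn S} {p q : Config S T} {Γ : S.Var → Option T}
    {t : List (Event S T)} (hR : Regular E p.1) (hΓ : Agree E Γ p.2 p.1)
    (h : Path (CStep E) p t q) :
    ∃ Γ', Path (BStep E) (p.1.inst Γ) t (q.1.inst Γ') ∧ Agree E Γ' q.2 q.1 := by
  induction h generalizing Γ with
  | nil => exact ⟨Γ, .nil _, hΓ⟩
  | cons h1 _ ih =>
    obtain ⟨Γ', h2, h3⟩ := CStep.exists_bStep hR hΓ h1
    obtain ⟨Γ'', h4, h5⟩ := ih (hR.cStep h1) h3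
    exact ⟨Γ'', .cons h2 h4, h5⟩

/-- The traces (`X = none`) and failures (`X = some Y`) of a process syntax with a valuation. -/
def Behav (E : Defn S) (p : Config S T) (t : List (Event S T)) (X : Option (Set (Event S T))) :
    Prop :=
  ∃ q, Path (CStep E) p t q ∧ ∀ Y, X = some Y → CFail E q.2 Y q.1

theorem mem_traces_inst {E : Defn S} {P : Syn S} {Γ : S.Var → Option T} {γ : S.Var → T}
    (hR : Regular E P) (hΓ : Agree E Γ γ P) {t : List (Event S T)} :
    t ∈ ((P.inst Γ).lts E).traces ↔ Behav E (P, γ) t none := by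
  rw [mem_traces_lts]
  constructor
  · rintro ⟨R, h⟩
    obtain ⟨q, Γ', h1, -⟩ := exists_path_cStep hR hΓ h
    exact ⟨q, h1, fun Y hY => by cases hY⟩
  · rintro ⟨q, h, -⟩
    obtain ⟨Γ', h1, -⟩ := exists_path_bStep (p := (P, γ)) hR hΓ h
    exact ⟨_, h1⟩

theorem mem_failures_inst [Nonempty T] {E : Defn S} {P : Syn S} {Γ : S.Var → Option T}
    {γ : S.Var → T} (hR : Regular E P) (hΓ : Agree E Γ γ P) {t : List (Event S T)}
    {X : Set (Event S T)} :
    (t, X) ∈ ((P.inst Γ).lts E).failures ↔ Behav E (P, γ) t (some X) := by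
  rw [mem_failures_lts]
  constructor
  · rintro ⟨R, h, hf⟩
    obtain ⟨q, Γ', h1, rfl, h2⟩ := exists_path_cStep hR hΓ h
    refine ⟨q, h1, fun Y hY => ?_⟩
    cases hY
    exact hf.cFail (Regular.path (p := (P, γ)) hR h1) h2
  · rintro ⟨q, h, hf⟩
    obtain ⟨Γ', h1, h2⟩ := exists_path_bStep (p := (P, γ)) hR hΓ h
    exact ⟨_, h1, (hf X rfl).fail (Regular.path (p := (P, γ)) hR h) h2⟩

/-! ## Symbolic traces -/

theorem Path.map_silent {E : Defn S} {P R : Syn S} {ρ : List (SLabel S)} (f : Syn S → Syn S)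
    (hf : ∀ l A B, ¬ l.IsVisible → SStep E A l B → SStep E (f A) l (f B))
    (h : Path (SStep E) P ρ R) (hρ : ∀ l ∈ ρ, ¬ l.IsVisible) : Path (SStep E) (f P) ρ (f R) := by
  induction h with
  | nil => exact .nil _
  | cons h1 _ ih =>
    exact .cons (hf _ _ _ (hρ _ (by simp)) h1) (ih fun l hl => hρ l (by simp [hl]))

/-- The visible symbolic event `ε` is available in `P`, such that all the conditions before it are
true in the valuation `γ`, and leads to `Q`. -/
def Offers (E : Defn S) (γ : S.Var → T) (P : Syn S) (ε : SEvent S) (Q : Syn S) : Prop :=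
  ∃ ρ R, Path (SStep E) P ρ R ∧ (∀ l ∈ ρ, ¬ l.IsVisible) ∧ EvalTrue (fun x => some (γ x)) ρ ∧
    SStep E R (.vis ε) Q

theorem Offers.map {E : Defn S} {γ : S.Var → T} {P Q : Syn S} {ε : SEvent S}
    (f : Syn S → Syn S)
    (hf : ∀ l A B, ¬ l.IsVisible → SStep E A l B → SStep E (f A) l (f B))
    (hv : ∀ A B, SStep E A (.vis ε) B → SStep E (f A) (.vis ε) B)
    (h : Offers E γ P ε Q) : Offers E γ (f P) ε Q := by
  obtain ⟨ρ, R, h1, h2, h3, h4⟩ := h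
  exact ⟨ρ, f R, h1.map_silent f hf h2, h2, h3, hv _ _ h4⟩

theorem Offers.lift {E : Defn S} {γ : S.Var → T} {P P' Q : Syn S} {ε : SEvent S}
    (hf : ∀ l B, SStep E P l B → SStep E P' l B) (h : Offers E γ P ε Q) : Offers E γ P' ε Q := by
  obtain ⟨ρ, R, h1, h2, h3, h4⟩ := h
  cases h1 with
  | nil => exact ⟨[], P', .nil _, h2, h3, hf _ _ h4⟩
  | cons h5 h6 => exact ⟨_, R, .cons (hf _ _ h5) h6, h2, h3, h4⟩

theorem Offers.cons {E : Defn S} {γ : S.Var → T} {P P' Q : Syn S} {ε : SEvent S} {l : SLabel S}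
    (hl : ¬ l.IsVisible)
    (hg : ∀ g, l = .cond g → g.Eval γ)
    (hs : SStep E P' l P) (h : Offers E γ P ε Q) : Offers E γ P' ε Q := by
  obtain ⟨ρ, R, h1, h2, h3, h4⟩ := h
  refine ⟨l :: ρ, R, .cons hs h1, ?_, fun g hmem => ?_, h4⟩
  · simpa using ⟨hl, h2⟩
  · rcases List.mem_cons.1 hmem with h | h
    · exact ⟨Guard.closed_subst_some γ g, hg g h.symm⟩
    · exact h3 g h

theorem not_isVisible_tau : ¬ (SLabel.tau : SLabel S).IsVisible := by
  rintro ⟨ε, h⟩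
  cases h

theorem not_isVisible_cond (g : Guard S Empty) : ¬ (SLabel.cond g).IsVisible := by
  rintro ⟨ε, h⟩
  cases h

/-- This connects runs on configurations with the symbolic semantics, so that the constructs met in
a run are counted by the threshold. -/
theorem Init.offers {E : Defn S} {γ : S.Var → T} {P : Syn S} {c : S.Chan}
    {tf : TPos S c → TField S Empty} {nf : NPos S c → NField S c} {k : (NPos S c → S.Val) → Syn S}
    (h : Init E γ P (.pre c tf nf k)) {w : NPos S c → S.Val} (hw : NAdmissible nf w) :
    Offers E γ P ⟨c, tf, w⟩ (k w) := by
  generalize hr : Term.pre c tf nf k = r at h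
  induction h with
  | pre =>
    cases hr
    -- If there are selections not of type `t`, they are resolved by `w` itself in one internal
    -- step, which leaves `w` admissible.
    by_cases hN : HasNdN nf
    · refine .cons not_isVisible_tau (fun g hg => by cases hg) (SStep.selN w hN hw.nd_mem)
        ⟨[], _, .nil _, by simp, fun g hg => by simp at hg, ?_⟩
      have := SStep.comm (E := E) (tf := tf) (k := fun w' => k (chosen nf w w')) w
        (not_hasNdN_resolveN nf w)
        ((nAdmissible_resolveN hw.nd_mem).2 ⟨hw, fun _ _ _ => rfl⟩)
      rwa [chosen_eq fun _ _ _ => rfl] at this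
    · exact ⟨[], _, .nil _, by simp, fun g hg => by simp at hg, .comm w hN hw⟩
  | extL _ ih =>
    exact (ih hr).map (Term.ext · _) (fun _ _ _ => .extSilentL) (fun _ _ => .extL)
  | extR _ ih =>
    exact (ih hr).map (Term.ext _ ·) (fun _ _ _ => .extSilentR) (fun _ _ => .extR)
  | intL _ ih => exact .cons not_isVisible_tau (fun g hg => by cases hg) .intL (ih hr)
  | intR _ ih => exact .cons not_isVisible_tau (fun g hg => by cases hg) .intR (ih hr)
  | slideL _ ih =>
    exact (ih hr).map (Term.slide · _) (fun _ _ _ => .slideSilent) (fun _ _ => .slideVis)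
  | slideR _ ih => exact .cons not_isVisible_tau (fun g hg => by cases hg) .slideOut (ih hr)
  | ifNTrue _ ih => exact (ih hr).lift fun _ _ => .ifNTrue
  | ifNFalse _ ih => exact (ih hr).lift fun _ _ => .ifNFalse
  | ifTTrue hg _ ih =>
    exact .cons (not_isVisible_cond _) (fun g h => by cases h; exact hg) .ifTThen (ih hr)
  | ifTFalse hg _ ih =>
    exact .cons (not_isVisible_cond _) (fun g h => by cases h; exact hg) .ifTElse (ih hr)
  | call _ ih => exact .cons not_isVisible_tau (fun g hg => by cases hg) .call (ih hr)

/-- Each event contributes some silent labels followed by one visible symbolic event, so the trace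
has the form required in the second maximum of the threshold. -/
theorem exists_symbolic_path {E : Defn S} {p q : Config S T} {t : List (Event S T)}
    (h : Path (CStep E) p t q) :
    ∃ σ, Path (SStep E) p.1 σ q.1 ∧ (σ = [] ∨ ∃ l, σ.getLast? = some l ∧ l.IsVisible) := by
  induction h with
  | nil => exact ⟨[], .nil _, .inl rfl⟩
  | cons h1 _ ih =>
    obtain ⟨σ, h2, h3⟩ := ih
    obtain ⟨tf, nf, k, h4, h5, -, rfl⟩ := h1
    obtain ⟨ρ, R, h6, -, -, h7⟩ := h4.offers h5
    refine ⟨_, h6.append (.cons h7 h2), .inr ?_⟩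
    rcases h3 with rfl | ⟨l, h8, h9⟩
    · exact ⟨_, List.getLast?_concat, _, rfl⟩
    · refine ⟨l, ?_, h9⟩
      rw [List.getLast?_append, List.getLast?_cons, h8]
      simp

/-! ## Transfer along functions of the values of type `t` -/

theorem Behav.cons_iff {E : Defn S} {p : Config S T} {e : Event S T} {t : List (Event S T)}
    {X : Option (Set (Event S T))} :
    Behav E p (e :: t) X ↔ ∃ q, CStep E p e q ∧ Behav E q t X := by
  constructor
  · rintro ⟨q, h, hX⟩
    cases h with
    | cons h1 h2 => exact ⟨_, h1, _, h2, hX⟩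
  · rintro ⟨q, h1, q', h2, hX⟩
    exact ⟨q', .cons h1 h2, hX⟩

/-- This is the refinement between the branches of a conditional, carried over to configurations. It
is used when a condition is false before collapsing and true afterwards. -/
theorem Regular.behav_else {E : Defn S} {g : Guard S Empty} {A B : Syn S}
    (hR : Regular E (.ifT g A B)) {m : ℕ} (hm : 1 ≤ m) {γ : S.Var → Fin m}
    {t : List (Event S (Fin m))} {X : Option (Set (Event S (Fin m)))}
    (h : Behav E (A, γ) t X) : Behav E (B, γ) t X := by
  have hA := hR.of_within (.ifTL (.refl A))
  have hB := hR.of_within (.ifTR (.refl B))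
  have : Nonempty (Fin m) := ⟨⟨0, hm⟩⟩
  have href := (hR.rev g A B (.refl _)).2 m hm γ
  have hag : ∀ P, Agree E (fun x => some (γ x)) γ P := fun _ _ _ => rfl
  cases X with
  | none => exact (mem_traces_inst hB (hag B)).1 (href.1 ((mem_traces_inst hA (hag A)).2 h))
  | some Y => exact (mem_failures_inst hB (hag B)).1 (href.2 ((mem_failures_inst hA (hag A)).2 h))

/-- A behaviour of the image under `ψ` of a configuration, that starts on the channel of an initial
construct of the configuration, is one of that construct. -/
theorem Init.behav_comp {E : Defn S} {m : ℕ} (hm : 1 ≤ m) {ψ : T → Fin m} {γ : S.Var → T}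
    {P : Syn S} {c : S.Chan} {tf : TPos S c → TField S Empty} {nf : NPos S c → NField S c}
    {k : (NPos S c → S.Val) → Syn S} (h : Init E γ P (.pre c tf nf k)) (hR : Regular E P)
    {v : TPos S c → Fin m} {w : NPos S c → S.Val} {t : List (Event S (Fin m))}
    {X : Option (Set (Event S (Fin m)))} (hb : Behav E (P, ψ ∘ γ) (⟨c, v, w⟩ :: t) X) :
    NAdmissible nf w ∧ TMatch (ψ ∘ γ) tf v ∧ Behav E (k w, upd (ψ ∘ γ) tf v) t X := by
  generalize hr : Term.pre c tf nf k = r at h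
  have chan : ∀ {A : Syn S}, Init E γ A r → c ∈ channels E A := by
    rintro A hA
    subst hr
    exact hA.mem_channels
  induction h with
  | pre =>
    cases hr
    obtain ⟨q, ⟨tf', nf', k', hi, hw, ht, rfl⟩, hq⟩ := Behav.cons_iff.1 hb
    cases hi
    exact ⟨hw, ht, hq⟩
  | extL hi ih =>
    refine ih (hR.of_within (.extL (.refl _))) ?_ hr chan
    obtain ⟨q, ⟨tf', nf', k', hi', h'⟩, hq⟩ := Behav.cons_iff.1 hb
    cases hi' with
    | extL hi' => exact Behav.cons_iff.2 ⟨q, ⟨tf', nf', k', hi', h'⟩, hq⟩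
    | extR hi' =>
      -- The event would start in the other argument, but its channel is already an initial channel
      -- of this one.
      exact (Set.disjoint_left.1 (hR.ext_disj _ _ (.refl _)) (chan hi) hi'.mem_channels).elim
  | extR hi ih =>
    refine ih (hR.of_within (.extR (.refl _))) ?_ hr chan
    obtain ⟨q, ⟨tf', nf', k', hi', h'⟩, hq⟩ := Behav.cons_iff.1 hb
    cases hi' with
    | extR hi' => exact Behav.cons_iff.2 ⟨q, ⟨tf', nf', k', hi', h'⟩, hq⟩
    | extL hi' =>
      exact (Set.disjoint_left.1 (hR.ext_disj _ _ (.refl _)) hi'.mem_channels (chan hi)).elim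
  | intL hi ih =>
    refine ih (hR.of_within (.intL (.refl _))) ?_ hr chan
    obtain ⟨q, ⟨tf', nf', k', hi', h'⟩, hq⟩ := Behav.cons_iff.1 hb
    cases hi' with
    | intL hi' => exact Behav.cons_iff.2 ⟨q, ⟨tf', nf', k', hi', h'⟩, hq⟩
    | intR hi' =>
      exact (Set.disjoint_left.1 (hR.int_disj _ _ (.refl _)) (chan hi) hi'.mem_channels).elim
  | intR hi ih =>
    refine ih (hR.of_within (.intR (.refl _))) ?_ hr chan
    obtain ⟨q, ⟨tf', nf', k', hi', h'⟩, hq⟩ := Behav.cons_iff.1 hb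
    cases hi' with
    | intR hi' => exact Behav.cons_iff.2 ⟨q, ⟨tf', nf', k', hi', h'⟩, hq⟩
    | intL hi' =>
      exact (Set.disjoint_left.1 (hR.int_disj _ _ (.refl _)) hi'.mem_channels (chan hi)).elim
  | slideL hi ih =>
    refine ih (hR.of_within (.slideL (.refl _))) ?_ hr chan
    obtain ⟨q, ⟨tf', nf', k', hi', h'⟩, hq⟩ := Behav.cons_iff.1 hb
    cases hi' with
    | slideL hi' => exact Behav.cons_iff.2 ⟨q, ⟨tf', nf', k', hi', h'⟩, hq⟩
    | slideR hi' =>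
      exact (Set.disjoint_left.1 (hR.slide_disj _ _ (.refl _)) (chan hi) hi'.mem_channels).elim
  | slideR hi ih =>
    refine ih (hR.of_within (.slideR (.refl _))) ?_ hr chan
    obtain ⟨q, ⟨tf', nf', k', hi', h'⟩, hq⟩ := Behav.cons_iff.1 hb
    cases hi' with
    | slideR hi' => exact Behav.cons_iff.2 ⟨q, ⟨tf', nf', k', hi', h'⟩, hq⟩
    | slideL hi' =>
      exact (Set.disjoint_left.1 (hR.slide_disj _ _ (.refl _)) hi'.mem_channels (chan hi)).elim
  | ifNTrue hi ih =>
    refine ih (hR.of_within (.ifNL (.refl _))) ?_ hr chan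
    obtain ⟨q, ⟨tf', nf', k', hi', h'⟩, hq⟩ := Behav.cons_iff.1 hb
    cases hi' with
    | ifNTrue hi' => exact Behav.cons_iff.2 ⟨q, ⟨tf', nf', k', hi', h'⟩, hq⟩
  | ifNFalse hi ih =>
    refine ih (hR.of_within (.ifNR (.refl _))) ?_ hr chan
    obtain ⟨q, ⟨tf', nf', k', hi', h'⟩, hq⟩ := Behav.cons_iff.1 hb
    cases hi' with
    | ifNFalse hi' => exact Behav.cons_iff.2 ⟨q, ⟨tf', nf', k', hi', h'⟩, hq⟩
  | ifTTrue hg hi ih =>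
    refine ih (hR.of_within (.ifTL (.refl _))) ?_ hr chan
    obtain ⟨q, ⟨tf', nf', k', hi', h'⟩, hq⟩ := Behav.cons_iff.1 hb
    cases hi' with
    | ifTTrue _ hi' => exact Behav.cons_iff.2 ⟨q, ⟨tf', nf', k', hi', h'⟩, hq⟩
    | ifTFalse hg' _ =>
      exact (hg' ((hR.rev _ _ _ (.refl _)).1.eval_comp ψ hg)).elim
  | ifTFalse hg hi ih =>
    refine ih (hR.of_within (.ifTR (.refl _))) ?_ hr chan
    obtain ⟨q, ⟨tf', nf', k', hi', h'⟩, hq⟩ := Behav.cons_iff.1 hb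
    cases hi' with
    | ifTTrue _ hi' =>
      -- The collapse has made the condition true; the behaviour of the first branch is also one of
      -- the second, where the construct lies.
      exact hR.behav_else hm (Behav.cons_iff.2 ⟨q, ⟨tf', nf', k', hi', h'⟩, hq⟩)
    | ifTFalse _ hi' => exact Behav.cons_iff.2 ⟨q, ⟨tf', nf', k', hi', h'⟩, hq⟩
  | call hi ih =>
    refine ih (hR.of_within (.call (.refl _))) ?_ hr chan
    obtain ⟨q, ⟨tf', nf', k', hi', h'⟩, hq⟩ := Behav.cons_iff.1 hb
    cases hi' with
    | call hi' => exact Behav.cons_iff.2 ⟨q, ⟨tf', nf', k', hi', h'⟩, hq⟩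

/-- Iterating `Init.behav_comp` removes the image of `t` event by event. The conclusion holds for
whichever configuration the path reaches, so one path for `t` later serves both its next event and
its refusals. -/
theorem Behav.of_path {E : Defn S} {m : ℕ} (hm : 1 ≤ m) (ψ : T → Fin m) {p q : Config S T}
    {t : List (Event S T)} (h : Path (CStep E) p t q) (hR : Regular E p.1)
    {s : List (Event S (Fin m))} {X : Option (Set (Event S (Fin m)))}
    (hb : Behav E (p.1, ψ ∘ p.2) (t.map (Event.map ψ) ++ s) X) :
    Behav E (q.1, ψ ∘ q.2) s X := by
  induction h with
  | nil => exact hb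
  | cons h1 _ ih =>
    refine ih (hR.cStep h1) ?_
    obtain ⟨tf, nf, k, h2, h3, h4, rfl⟩ := h1
    dsimp only
    rw [comp_upd]
    exact (h2.behav_comp hm hR hb).2.2

/-- Convergent process syntaxes with valuations. -/
inductive CConv (E : Defn S) (γ : S.Var → T) : Syn S → Prop
  | deadlock : CConv E γ .STOP
  | pre {c : S.Chan} {tf : TPos S c → TField S Empty} {nf : NPos S c → NField S c}
      {k : (NPos S c → S.Val) → Syn S} : CConv E γ (.pre c tf nf k)
  | ext {P Q : Syn S} : CConv E γ P → CConv E γ Q → CConv E γ (.ext P Q)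
  | int {P Q : Syn S} : CConv E γ P → CConv E γ Q → CConv E γ (.int P Q)
  | slide {P Q : Syn S} : CConv E γ P → CConv E γ Q → CConv E γ (.slide P Q)
  | ifNTrue {P Q : Syn S} : CConv E γ P → CConv E γ (.ifN true P Q)
  | ifNFalse {P Q : Syn S} : CConv E γ Q → CConv E γ (.ifN false P Q)
  | ifTTrue {g : Guard S Empty} {P Q : Syn S} :
      g.Eval γ → CConv E γ P → CConv E γ (.ifT g P Q)
  | ifTFalse {g : Guard S Empty} {P Q : Syn S} :
      ¬ g.Eval γ → CConv E γ Q → CConv E γ (.ifT g P Q)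
  | call {Y : S.Ident} {Γ : S.Var → Option Empty} : CConv E γ (E Y) → CConv E γ (.call Y Γ)

theorem Conv.cConv {E : Defn S} {P : Syn S} {Γ : S.Var → Option T} {γ : S.Var → T}
    (hΓ : Agree E Γ γ P) (h : Conv E (P.inst Γ)) : CConv E γ P := by
  generalize hs : P.inst Γ = s at h
  induction h generalizing P Γ with
  | deadlock =>
    cases P with
    | STOP => exact .deadlock
    | _ => cases hs
  | pre =>
    cases P with
    | pre => exact .pre
    | _ => cases hs
  | ext _ _ ih1 ih2 =>
    cases P with
    | ext P Q =>
      cases hs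
      exact .ext (ih1 (fun x hx => hΓ x (.extL hx)) rfl) (ih2 (fun x hx => hΓ x (.extR hx)) rfl)
    | _ => cases hs
  | int _ _ ih1 ih2 =>
    cases P with
    | int P Q =>
      cases hs
      exact .int (ih1 (fun x hx => hΓ x (.intL hx)) rfl) (ih2 (fun x hx => hΓ x (.intR hx)) rfl)
    | _ => cases hs
  | slide _ _ ih1 ih2 =>
    cases P with
    | slide P Q =>
      cases hs
      exact .slide (ih1 (fun x hx => hΓ x (.slideL hx)) rfl)
        (ih2 (fun x hx => hΓ x (.slideR hx)) rfl)
    | _ => cases hs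
  | ifNTrue _ ih =>
    cases P with
    | ifN b P Q =>
      cases hs
      exact .ifNTrue (ih (fun x hx => hΓ x (.ifNL hx)) rfl)
    | _ => cases hs
  | ifNFalse _ ih =>
    cases P with
    | ifN b P Q =>
      cases hs
      exact .ifNFalse (ih (fun x hx => hΓ x (.ifNR hx)) rfl)
    | _ => cases hs
  | ifTTrue _ hg _ ih =>
    cases P with
    | ifT g P Q =>
      cases hs
      rw [Guard.subst_embed_of_agree hΓ] at hg
      exact .ifTTrue hg (ih (fun x hx => hΓ x (.ifTL hx)) rfl)
    | _ => cases hs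
  | ifTFalse _ hg _ ih =>
    cases P with
    | ifT g P Q =>
      cases hs
      rw [Guard.subst_embed_of_agree hΓ] at hg
      exact .ifTFalse hg (ih (fun x hx => hΓ x (.ifTR hx)) rfl)
    | _ => cases hs
  | ifTOpen hc =>
    cases P with
    | ifT g P Q =>
      cases hs
      rw [Guard.subst_embed_of_agree hΓ] at hc
      exact (hc (Guard.closed_subst_some γ g)).elim
    | _ => cases hs
  | call _ ih =>
    cases P with
    | call X Δ =>
      simp only [Term.inst, Term.embed, Term.subst, Option.none_or, Term.call.injEq] at hs
      obtain ⟨rfl, rfl⟩ := hs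
      exact .call (ih (fun x hx => hΓ x (.call hx)) rfl)
    | _ => cases hs

/-- If the image under `ψ` of a convergent configuration can perform an event, then the
configuration has an initial construct on its channel. -/
theorem CConv.exists_init {E : Defn S} {m : ℕ} (hm : 1 ≤ m) {ψ : T → Fin m} {γ : S.Var → T}
    {P : Syn S} (h : CConv E γ P) (hR : Regular E P) {e : Event S (Fin m)}
    (hb : ∃ q, CStep E (P, ψ ∘ γ) e q) :
    ∃ tf nf k, Init E γ P (.pre e.chan tf nf k) := by
  obtain ⟨q, tf', nf', k', hi', h'⟩ := hb
  replace hi' : Init E (ψ ∘ γ) P (.pre e.chan tf' nf' k') := hi'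
  induction h generalizing tf' nf' k' q with
  | deadlock => cases hi'
  | pre =>
    cases hi'
    exact ⟨_, _, _, .pre ..⟩
  | ext _ _ ih1 ih2 =>
    cases hi' with
    | extL hi' =>
      obtain ⟨tf, nf, k, h⟩ := ih1 (hR.of_within (.extL (.refl _))) q tf' nf' k' h' hi'
      exact ⟨tf, nf, k, .extL h⟩
    | extR hi' =>
      obtain ⟨tf, nf, k, h⟩ := ih2 (hR.of_within (.extR (.refl _))) q tf' nf' k' h' hi'
      exact ⟨tf, nf, k, .extR h⟩
  | int _ _ ih1 ih2 =>
    cases hi' with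
    | intL hi' =>
      obtain ⟨tf, nf, k, h⟩ := ih1 (hR.of_within (.intL (.refl _))) q tf' nf' k' h' hi'
      exact ⟨tf, nf, k, .intL h⟩
    | intR hi' =>
      obtain ⟨tf, nf, k, h⟩ := ih2 (hR.of_within (.intR (.refl _))) q tf' nf' k' h' hi'
      exact ⟨tf, nf, k, .intR h⟩
  | slide _ _ ih1 ih2 =>
    cases hi' with
    | slideL hi' =>
      obtain ⟨tf, nf, k, h⟩ := ih1 (hR.of_within (.slideL (.refl _))) q tf' nf' k' h' hi'
      exact ⟨tf, nf, k, .slideL h⟩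
    | slideR hi' =>
      obtain ⟨tf, nf, k, h⟩ := ih2 (hR.of_within (.slideR (.refl _))) q tf' nf' k' h' hi'
      exact ⟨tf, nf, k, .slideR h⟩
  | ifNTrue _ ih =>
    cases hi' with
    | ifNTrue hi' =>
      obtain ⟨tf, nf, k, h⟩ := ih (hR.of_within (.ifNL (.refl _))) q tf' nf' k' h' hi'
      exact ⟨tf, nf, k, .ifNTrue h⟩
  | ifNFalse _ ih =>
    cases hi' with
    | ifNFalse hi' =>
      obtain ⟨tf, nf, k, h⟩ := ih (hR.of_within (.ifNR (.refl _))) q tf' nf' k' h' hi'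
      exact ⟨tf, nf, k, .ifNFalse h⟩
  | ifTTrue hg _ ih =>
    cases hi' with
    | ifTTrue _ hi' =>
      obtain ⟨tf, nf, k, h⟩ := ih (hR.of_within (.ifTL (.refl _))) q tf' nf' k' h' hi'
      exact ⟨tf, nf, k, .ifTTrue hg h⟩
    | ifTFalse hg' _ => exact (hg' ((hR.rev _ _ _ (.refl _)).1.eval_comp ψ hg)).elim
  | @ifTFalse g A B hg _ ih =>
    -- The induction hypothesis concerns the second branch, but the image may have taken the first;
    -- by refinement the second can perform the event too, possibly with another successor.
    have hB : ∃ q', CStep E (B, ψ ∘ γ) e q' := by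
      cases hi' with
      | ifTTrue _ hi' =>
        have hA : Behav E (A, ψ ∘ γ) [e] none :=
          ⟨q, .cons ⟨tf', nf', k', hi', h'⟩ (.nil _), fun Y hY => by cases hY⟩
        obtain ⟨q', hq', -⟩ := Behav.cons_iff.1 (hR.behav_else hm hA)
        exact ⟨q', hq'⟩
      | ifTFalse _ hi' => exact ⟨q, tf', nf', k', hi', h'⟩
    obtain ⟨q', tf', nf', k', hi', h'⟩ := hB
    obtain ⟨tf, nf, k, h⟩ := ih (hR.of_within (.ifTR (.refl _))) q' tf' nf' k' h' hi'
    exact ⟨tf, nf, k, .ifTFalse hg h⟩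
  | call _ ih =>
    cases hi' with
    | call hi' =>
      obtain ⟨tf, nf, k, h⟩ := ih (hR.of_within (.call (.refl _))) q tf' nf' k' h' hi'
      exact ⟨tf, nf, k, .call h⟩

/-- `a` is the only value that `ψ` maps to `ψ a`. -/
def InjAt {T T' : Type} (ψ : T → T') (a : T) : Prop := ∀ b, ψ b = ψ a → b = a

/-- Without inputs, the values of the nondeterministic selections determine those of the outputs. -/
theorem existsUnique_nAdmissible {c : S.Chan} {nf : NPos S c → NField S c}
    (hout : ∀ j f, nf j = .out f → ∀ w w' : NPos S c → S.Val,
      (∀ l, (∀ f', nf l ≠ .out f') → w l = w' l) → f w = f w')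
    (hinp : ∀ j X, nf j ≠ .inp X) {u : NPos S c → S.Val} (hu : ∀ j Y, nf j = .nd Y → u j ∈ Y) :
    ∃ w, NAdmissible nf w ∧ (∀ j Y, nf j = .nd Y → w j = u j) ∧
      ∀ w', NAdmissible nf w' → (∀ j Y, nf j = .nd Y → w' j = u j) → w' = w := by
  -- Outputs are evaluated at `u`; its own values at output positions have no influence, since
  -- outputs depend only on the other positions.
  let w : NPos S c → S.Val := fun j => match nf j with
    | .out f => f u
    | _ => u j
  have hnd : ∀ j Y, nf j = .nd Y → w j = u j := fun j Y hj => by simp [w, hj]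
  have hwout : ∀ j f, nf j = .out f → w j = f u := fun j f hj => by simp [w, hj]
  have hsame : ∀ w' : NPos S c → S.Val, (∀ j Y, nf j = .nd Y → w' j = u j) →
      ∀ j f, nf j = .out f → f w' = f u := by
    intro w' hw' j f hj
    refine hout j f hj w' u fun l hl => ?_
    cases hl' : nf l with
    | nd Y => exact hw' l Y hl'
    | inp Y => exact (hinp l Y hl').elim
    | out f' => exact (hl f' hl').elim
  refine ⟨w, fun j => ?_, hnd, fun w' hw' hnd' => funext fun j => ?_⟩
  · cases hj : nf j with
    | nd Y => simpa [hnd j Y hj] using hu j Y hj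
    | inp Y => exact (hinp j Y hj).elim
    | out f => simpa [hsame w hnd j f hj] using hwout j f hj
  · cases hj : nf j with
    | nd Y => rw [hnd' j Y hj, hnd j Y hj]
    | inp Y => exact (hinp j Y hj).elim
    | out f =>
      have := hw' j
      rw [hj] at this
      rw [hwout j f hj, ← hsame w' hnd' j f hj]
      exact this

/-- The collapsed refusal set contains an event only if all its preimages lie in `X`, so every event
the image offers has a preimage outside `X`. With a selection of type `t` there is no input, so a
resolution offers exactly one event, and the selections can be resolved as in that preimage. Without
such a selection, an offered event in `X` may be replaced by one whose input values are separated by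
`ψ`; its image then has no other preimage consistent with the construct, a contradiction. -/
theorem CFail.of_comp_pre {m : ℕ} {E : Defn S} {ψ : T → Fin m} {γ : S.Var → T}
    {X : Set (Event S T)} {c : S.Chan} {tf : TPos S c → TField S Empty}
    {nf : NPos S c → NField S c} {k : (NPos S c → S.Val) → Syn S} [Nonempty T]
    (hR : Regular E (.pre c tf nf k))
    (hψ : ∀ w, NAdmissible nf w → (∀ i x, tf i = .out (.inl x) → InjAt ψ (γ x)) ∧
      ((∃ v, TMatch γ tf v ∧ (⟨c, v, w⟩ : Event S T) ∈ X) →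
        ∃ v, TMatch γ tf v ∧ (⟨c, v, w⟩ : Event S T) ∈ X ∧ ∀ i x, tf i = .inp x → InjAt ψ (v i)))
    (hf : CFail E (ψ ∘ γ) {y | ∀ e : Event S T, e.map ψ = y → e ∈ X} (.pre c tf nf k)) :
    CFail E γ X (.pre c tf nf k) := by
  cases hf with
  | stuck h => exact .stuck h
  | pre u v hu hX =>
    have lift : ∀ {v' w}, (⟨c, v', w⟩ : Event S (Fin m)) ∉
        {y | ∀ e : Event S T, e.map ψ = y → e ∈ X} →
        ∃ a, ψ ∘ a = v' ∧ (⟨c, a, w⟩ : Event S T) ∉ X := by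
      intro v' w h
      simp only [Set.mem_ofPred_eq, not_forall] at h
      obtain ⟨⟨c', a, w'⟩, he, hne⟩ := h
      cases he
      exact ⟨a, rfl, hne⟩
    by_cases hT : HasNdT tf
    · obtain ⟨htinp, hninp⟩ := hR.mix c tf nf k (.refl _) hT
      obtain ⟨w, hw, hwu, huniq⟩ :=
        existsUnique_nAdmissible (hR.outputs c tf nf k (.refl _)) hninp hu
      -- The only event offered after this resolution: collapsed values of the variables at outputs,
      -- the selected values elsewhere, there being no inputs.
      let v' : TPos S c → Fin m := fun i => match tf i with
        | .out (.inl x) => ψ (γ x)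
        | _ => v i
      have hout : ∀ i x, tf i = .out (.inl x) → v' i = ψ (γ x) := fun i x hi => by simp [v', hi]
      obtain ⟨a, ha, hne⟩ := lift (hX v' w hw hwu hout fun i x hi => by simp [v', hi])
      refine .pre u a hu fun b w' hw' hwu' hb hba => ?_
      obtain rfl := huniq w' hw' hwu'
      have : b = a := by
        funext i
        cases hi : tf i with
        | nd x => exact hba i x hi
        | inp x => exact (htinp i x hi).elim
        | out y =>
          rcases y with x | y
          · rw [hb i x hi]
            refine ((hψ w' hw).1 i x hi (a i) ?_).symm
            rw [← hout i x hi, ← ha]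
            rfl
          · exact y.elim
      rwa [this]
    -- The selected values of type `t` are irrelevant, as there are no such selections.
    · refine .pre u (fun _ => Classical.arbitrary T) hu fun b w hw hwu hb _ hmem => ?_
      obtain ⟨b', hb', hmem', hinj⟩ := (hψ w hw).2 ⟨b, hb, hmem⟩
      obtain ⟨a, ha, hne⟩ := lift (hX (ψ ∘ b') w hw hwu (fun i x hi => by simp [hb' i x hi])
        fun i x hi => (hT ⟨i, x, hi⟩).elim)
      have : a = b' := by
        funext i
        have hai : ψ (a i) = ψ (b' i) := congrFun ha i
        cases hi : tf i with
        | nd x => exact (hT ⟨i, x, hi⟩).elim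
        | inp x => exact hinj i x hi _ hai
        | out y =>
          rcases y with x | y
          · rw [hb' i x hi] at hai ⊢
            exact (hψ w hw).1 i x hi _ hai
          · exact y.elim
      exact hne (this ▸ hmem')

/-- Induction on convergence reduces this to single prefixes. One `ψ` must be good for all initial
constructs, because an external choice refuses only what both arguments refuse. -/
theorem CFail.of_comp {m : ℕ} (hm : 1 ≤ m) {E : Defn S} {ψ : T → Fin m} {γ : S.Var → T}
    {X : Set (Event S T)} {P : Syn S} [Nonempty T] (hc : CConv E γ P) (hR : Regular E P)
    (hψ : ∀ c tf nf k, Init E γ P (.pre c tf nf k) → ∀ w, NAdmissible nf w →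
      (∀ i x, tf i = .out (.inl x) → InjAt ψ (γ x)) ∧
      ((∃ v, TMatch γ tf v ∧ (⟨c, v, w⟩ : Event S T) ∈ X) →
        ∃ v, TMatch γ tf v ∧ (⟨c, v, w⟩ : Event S T) ∈ X ∧ ∀ i x, tf i = .inp x → InjAt ψ (v i)))
    (hf : CFail E (ψ ∘ γ) {y | ∀ e : Event S T, e.map ψ = y → e ∈ X} P) :
    CFail E γ X P := by
  induction hc with
  | deadlock => exact .deadlock
  | pre => exact .of_comp_pre hR (hψ _ _ _ _ (.pre ..)) hf
  | ext _ _ ih1 ih2 =>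
    cases hf with
    | ext h1 h2 =>
      exact .ext (ih1 (hR.of_within (.extL (.refl _))) (fun c tf nf k h => hψ c tf nf k (.extL h)) h1)
        (ih2 (hR.of_within (.extR (.refl _))) (fun c tf nf k h => hψ c tf nf k (.extR h)) h2)
  | int _ _ ih1 ih2 =>
    cases hf with
    | intL h1 =>
      exact .intL
        (ih1 (hR.of_within (.intL (.refl _))) (fun c tf nf k h => hψ c tf nf k (.intL h)) h1)
    | intR h2 =>
      exact .intR
        (ih2 (hR.of_within (.intR (.refl _))) (fun c tf nf k h => hψ c tf nf k (.intR h)) h2)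
  | slide _ _ _ ih =>
    cases hf with
    | slide h =>
      exact .slide
        (ih (hR.of_within (.slideR (.refl _))) (fun c tf nf k h => hψ c tf nf k (.slideR h)) h)
  | ifNTrue _ ih =>
    cases hf with
    | ifNTrue h =>
      exact .ifNTrue
        (ih (hR.of_within (.ifNL (.refl _))) (fun c tf nf k h => hψ c tf nf k (.ifNTrue h)) h)
  | ifNFalse _ ih =>
    cases hf with
    | ifNFalse h =>
      exact .ifNFalse
        (ih (hR.of_within (.ifNR (.refl _))) (fun c tf nf k h => hψ c tf nf k (.ifNFalse h)) h)
  | ifTTrue hg _ ih =>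
    cases hf with
    | ifTTrue _ h =>
      exact .ifTTrue hg
        (ih (hR.of_within (.ifTL (.refl _))) (fun c tf nf k h => hψ c tf nf k (.ifTTrue hg h)) h)
    | ifTFalse hg' _ => exact (hg' ((hR.rev _ _ _ (.refl _)).1.eval_comp ψ hg)).elim
  | @ifTFalse g A B hg _ ih =>
    have hB : CFail E (ψ ∘ γ) {y | ∀ e : Event S T, e.map ψ = y → e ∈ X} B := by
      cases hf with
      | ifTTrue _ h =>
        have hA : Behav E (A, ψ ∘ γ) [] (some {y | ∀ e : Event S T, e.map ψ = y → e ∈ X}) :=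
          ⟨_, .nil _, fun Y hY => by cases hY; exact h⟩
        obtain ⟨q, hq, hY⟩ := hR.behav_else hm hA
        cases hq
        exact hY _ rfl
      | ifTFalse _ h => exact h
    exact .ifTFalse hg
      (ih (hR.of_within (.ifTR (.refl _))) (fun c tf nf k h => hψ c tf nf k (.ifTFalse hg h)) hB)
  | call _ ih =>
    cases hf with
    | call h =>
      exact .call
        (ih (hR.of_within (.call (.refl _))) (fun c tf nf k h => hψ c tf nf k (.call h)) h)

/-! ## Renaming and bisimilarity -/

namespace LTS

variable {Ev : Type u}

theorem weakPath_rename {Ev' : Type w} {M : LTS.{u, v} (Option Ev)} (f : Ev → Ev') {p q : M.State}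
    {t : List Ev} (h : M.WeakPath p t q) : (M.rename f).WeakPath p (t.map f) q := by
  obtain ⟨s, h, rfl⟩ := h
  refine ⟨s.map (Option.map f), ?_, ?_⟩
  · induction h with
    | nil => exact .nil _
    | cons h1 _ ih => exact .cons ⟨_, h1, rfl⟩ ih
  · rw [List.reduceOption_map]

/-- This is the largest refusal set that `X` justifies: an event may be refused after renaming only
when all its preimages are, and events without preimages are refused for free. -/
theorem refuses_rename {Ev' : Type w} {M : LTS.{u, v} (Option Ev)} (f : Ev → Ev') {q : M.State}
    {X : Set Ev} (h : M.Refuses q X) : (M.rename f).Refuses q {y | ∀ e, f e = y → e ∈ X} := by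
  refine ⟨?_, ?_⟩
  · rintro q' ⟨a, ha, hn⟩
    rw [Option.map_eq_none_iff] at hn
    exact h.1 q' (hn ▸ ha)
  · rintro y hy q' ⟨a, ha, hs⟩
    obtain ⟨e, rfl, he⟩ := Option.map_eq_some_iff.1 hs
    exact h.2 e (hy e he) q' ha

theorem Bisimilar.traces_subset {M : LTS.{u, v} (Option Ev)} {N : LTS.{u, w} (Option Ev)}
    (h : M.Bisimilar N) : N.traces ⊆ M.traces ∧ N.failures ⊆ M.failures := by
  obtain ⟨R, hstart, hR⟩ := h
  have path : ∀ {q q' s}, Path N.trans q s q' → ∀ p, R p q → ∃ p', Path M.trans p s p' ∧ R p' q' := by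
    intro q q' s hp
    induction hp with
    | nil => exact fun p hpq => ⟨p, .nil _, hpq⟩
    | cons h1 _ ih =>
      intro p hpq
      obtain ⟨p1, h2, h3⟩ := (hR _ _ hpq).2 _ _ h1
      obtain ⟨p', h4, h5⟩ := ih p1 h3
      exact ⟨p', .cons h2 h4, h5⟩
  constructor
  · rintro t ⟨q, s, hs, ht⟩
    obtain ⟨p, hp, -⟩ := path hs _ hstart
    exact ⟨p, s, hp, ht⟩
  · rintro ⟨t, X⟩ ⟨q, ⟨s, hs, ht⟩, hq1, hq2⟩
    obtain ⟨p, hp, hpq⟩ := path hs _ hstart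
    refine ⟨p, ⟨s, hp, ht⟩, fun p' hp' => ?_, fun e he p' hp' => ?_⟩
    · obtain ⟨q', hq', -⟩ := (hR _ _ hpq).1 _ _ hp'
      exact hq1 _ hq'
    · obtain ⟨q', hq', -⟩ := (hR _ _ hpq).1 _ _ hp'
      exact hq2 _ he _ hq'

theorem mem_traces_of_append {M : LTS.{u, v} (Option Ev)} {t t' : List Ev}
    (h : t ++ t' ∈ M.traces) : t ∈ M.traces := by
  have key : ∀ {p q s}, Path M.trans p s q → ∀ t t' : List Ev, s.reduceOption = t ++ t' →
      ∃ q, M.WeakPath p t q := by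
    intro p q s hp
    induction hp with
    | nil p =>
      intro t t' hs
      obtain ⟨rfl, -⟩ := List.append_eq_nil_iff.1 (hs.symm.trans List.reduceOption_nil)
      exact ⟨p, [], .nil _, rfl⟩
    | @cons p _ _ a s h1 _ ih =>
      intro t t' hs
      cases a with
      | none =>
        obtain ⟨q, s', h2, h3⟩ := ih t t' (by simpa using hs)
        exact ⟨q, none :: s', .cons h1 h2, by simpa using h3⟩
      | some e =>
        cases t with
        | nil => exact ⟨p, [], .nil _, rfl⟩
        | cons e' t =>
          simp only [List.reduceOption_cons_of_some, List.cons_append, List.cons.injEq] at hs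
          obtain ⟨q, s', h2, h3⟩ := ih t t' hs.2
          exact ⟨q, some e :: s', .cons h1 h2, by simp [h3, hs.1]⟩
  obtain ⟨q, s, hs, ht⟩ := h
  exact key hs t t' ht

end LTS

/-- The behaviours of the collapsed implementation are preserved by the permutations of the values
of type `t`. -/
theorem TypeSym.refined {I : (n : ℕ) → LTS.{u, v} (Option (Event S (Fin n)))} (hI : TypeSym I)
    {n : ℕ} (hn : 1 ≤ n) (π : Equiv.Perm (Fin n)) {T' : Type} (φ : Fin n → T')
    {M : LTS.{u, w} (Option (Event S T'))} (h : M.Refined ((I n).rename (Event.map φ))) :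
    (∀ t ∈ (I n).traces, t.map (Event.map (φ ∘ π)) ∈ M.traces) ∧
      ∀ t X, (t, X) ∈ (I n).failures →
        (t.map (Event.map (φ ∘ π)), {y | ∀ e : Event S (Fin n), e.map (φ ∘ π) = y → e ∈ X}) ∈
          M.failures := by
  have hb := (hI n hn π).traces_subset
  constructor
  · rintro t ⟨q, hq⟩
    -- Bisimilarity turns a trace permuted by `π` into a trace of the implementation itself, to
    -- which the hypothesis on `φ` applies.
    obtain ⟨q', hq'⟩ := hb.1 ⟨q, LTS.weakPath_rename (Event.map π) hq⟩
    have := h.1 ⟨q', LTS.weakPath_rename (Event.map φ) hq'⟩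
    rw [List.map_map] at this
    exact this
  · rintro t X ⟨q, hq, hX⟩
    obtain ⟨q', hq', hX'⟩ := hb.2 (show (t.map (Event.map π),
        {y | ∀ e, Event.map π e = y → e ∈ X}) ∈ ((I n).rename (Event.map π)).failures from
      ⟨q, LTS.weakPath_rename (Event.map π) hq, LTS.refuses_rename (Event.map π) hX⟩)
    have := h.2 (show (_, _) ∈ _ from ⟨q', LTS.weakPath_rename (Event.map φ) hq',
      LTS.refuses_rename (Event.map φ) hX'⟩)
    rw [List.map_map] at this
    have hset : {y | ∀ e : Event S (Fin n), e.map (φ ∘ π) = y → e ∈ X} =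
        {y | ∀ e, Event.map φ e = y → e ∈ {y | ∀ e, Event.map π e = y → e ∈ X}} := by
      ext y
      constructor
      · rintro hy e rfl e' rfl
        exact hy e' rfl
      · rintro hy e rfl
        exact hy (e.map π) rfl e rfl
    rw [hset]
    exact this

/-! ## Collapsing functions -/

/-- An enumeration of `U` is an injection into the first `B` values, and an injection between
subsets of a finite type extends to a permutation. -/
theorem exists_perm_lt {n B : ℕ} (hB : B ≤ n) {U : Set (Fin n)} (hU : U.encard ≤ B) :
    ∃ π : Equiv.Perm (Fin n), ∀ a ∈ U, (π a : ℕ) < B := by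
  classical
  have hc : Fintype.card U ≤ B := by
    rw [Set.encard_eq_coe_toFinset_card, Set.toFinset_card] at hU
    exact_mod_cast hU
  let g : U → Fin n := fun a => Fin.castLE (hc.trans hB) (Fintype.equivFin U a)
  have hg : Function.Injective g :=
    (Fin.castLE_injective _).comp (Fintype.equivFin U).injective
  obtain ⟨π, hπ⟩ := Equiv.Perm.exists_extending_pair (Subtype.val : U → Fin n) g
    Subtype.val_injective hg
  refine ⟨π, fun a ha => ?_⟩
  have := hπ ⟨a, ha⟩
  simp only at this
  rw [this]
  exact lt_of_lt_of_le (Fintype.equivFin U ⟨a, ha⟩).2 hc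

/-- Values below `B` are fixed by the collapse, and all the others go to `B`, so no other value
shares their image. -/
theorem IsCollapsing.injAt {B n : ℕ} {φ : Fin n → Fin (B + 1)} (hφ : IsCollapsing B φ)
    (π : Equiv.Perm (Fin n)) {a : Fin n} (ha : (π a : ℕ) < B) : InjAt (φ ∘ π) a := by
  intro b hb
  have h1 := (hφ (π a)).1 ha
  simp only [Function.comp] at hb
  by_cases hb' : (π b : ℕ) < B
  · have h2 := (hφ (π b)).1 hb'
    exact π.injective (Fin.ext (by rw [← h2, ← h1, hb]))
  · have h2 := (hφ (π b)).2 (not_lt.1 hb')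
    rw [hb] at h2
    omega

/-! ## Thresholds -/

theorem encard_biUnion_finset_le {ι α : Type*} (F : Finset ι) (f : ι → Set α) :
    (⋃ i ∈ F, f i).encard ≤ ∑ i ∈ F, (f i).encard := by
  classical
  induction F using Finset.induction_on with
  | empty => simp
  | insert a F ha ih =>
    rw [Finset.set_biUnion_insert, Finset.sum_insert ha]
    exact (Set.encard_union_le _ _).trans (by gcongr)

/-- The index set may be infinite, but the union is finite; choosing one index for each of its
elements already covers it with finitely many sets. -/
theorem encard_biUnion_le {ι α : Type*} [Finite α] (A : Set ι) (f : ι → Set α) :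
    (⋃ i ∈ A, f i).encard ≤ ⨆ (F : Finset ι) (_ : (F : Set ι) ⊆ A), ∑ i ∈ F, (f i).encard := by
  classical
  have hmem : ∀ a : (⋃ i ∈ A, f i : Set α), ∃ i ∈ A, a.1 ∈ f i := fun a => by
    obtain ⟨i, hi, ha⟩ := Set.mem_iUnion₂.1 a.2
    exact ⟨i, hi, ha⟩
  choose g hgA hg using hmem
  have := Fintype.ofFinite (⋃ i ∈ A, f i : Set α)
  let F : Finset ι := Finset.univ.image g
  have hF : (F : Set ι) ⊆ A := by
    intro i hi
    simp only [F, Finset.coe_image, Finset.coe_univ, Set.image_univ, Set.mem_range] at hi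
    obtain ⟨a, rfl⟩ := hi
    exact hgA a
  refine le_trans ?_ (le_iSup₂_of_le F hF (encard_biUnion_finset_le F f))
  refine Set.encard_le_encard fun a ha => ?_
  simp only [Set.mem_iUnion]
  exact ⟨g ⟨a, ha⟩, by simp [F], hg ⟨a, ha⟩⟩

theorem SEvent.encard_image_outT_le {ε : SEvent S} (v : TPos S ε.chan → T) :
    (v '' {i | ∃ a, ε.tf i = .out a}).encard ≤ ε.outT.encard := by
  have : ε.outT = (fun i : TPos S ε.chan => ((i : Fin (S.arity ε.chan)) : ℕ)) ''
      {i | ∃ a, ε.tf i = .out a} := by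
    ext p
    constructor
    · rintro ⟨i, a, rfl, h⟩
      exact ⟨i, ⟨a, h⟩, rfl⟩
    · rintro ⟨i, ⟨a, h⟩, rfl⟩
      exact ⟨i, a, rfl, h⟩
  have hinj : Function.Injective (fun i : TPos S ε.chan => ((i : Fin (S.arity ε.chan)) : ℕ)) :=
    Fin.val_injective.comp Subtype.val_injective
  rw [this, hinj.encard_image]
  exact Set.encard_image_le _ _

theorem SEvent.encard_image_inT_le {ε : SEvent S} (v : TPos S ε.chan → T) :
    (v '' {i | ∃ x, ε.tf i = .inp x}).encard ≤ ε.inT.encard := by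
  have : ε.inT = (fun i : TPos S ε.chan => ((i : Fin (S.arity ε.chan)) : ℕ)) ''
      {i | ∃ x, ε.tf i = .inp x} := by
    ext p
    constructor
    · rintro ⟨i, a, rfl, h⟩
      exact ⟨i, ⟨a, h⟩, rfl⟩
    · rintro ⟨i, ⟨a, h⟩, rfl⟩
      exact ⟨i, a, rfl, h⟩
  have hinj : Function.Injective (fun i : TPos S ε.chan => ((i : Fin (S.arity ε.chan)) : ℕ)) :=
    Fin.val_injective.comp Subtype.val_injective
  rw [this, hinj.encard_image]
  exact Set.encard_image_le _ _

theorem outT_encard_le_thresh {E : Defn S} {P : Syn S} {σ : List (SLabel S)} {ε : SEvent S}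
    (h : σ ++ [.vis ε] ∈ straces E P) : ε.outT.encard ≤ thresh E P T := by
  refine le_trans ?_ (le_max_left _ _)
  refine le_trans ?_ (le_iSup_of_le σ (le_iSup₂_of_le ε h le_rfl))
  exact Set.encard_le_encard fun p hp => ⟨σ, ε, h, rfl, hp⟩

theorem threshOut_add_threshIn_le_thresh {E : Defn S} {P : Syn S} {σ : List (SLabel S)}
    (h : σ ∈ straces E P) (hσ : σ = [] ∨ ∃ l, σ.getLast? = some l ∧ l.IsVisible)
    (Γ : S.Var → Option T) : threshOut E P σ Γ + threshIn E P σ Γ ≤ thresh E P T := by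
  refine le_trans ?_ (le_max_right _ _)
  refine le_iSup_of_le σ (le_iSup_of_le h (le_iSup_of_le hσ ?_))
  exact le_iSup (fun Γ : S.Var → Option T => threshOut E P σ Γ + threshIn E P σ Γ) Γ

theorem IsSeqNorm.regular {E : Defn S} {P : Syn S} (hnorm : IsSeqNorm E P)
    (hrev : RevPosConjEqTF E P) (hmix : NoMixedConstruct E P) : Regular E P where
  once := hnorm.once
  outputs := hnorm.outputs
  ext_disj A B h := (hnorm.ext_norm A B h).1
  int_disj A B h := (hnorm.int_norm A B h).1
  slide_disj A B h := (hnorm.slide_norm A B h).1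
  rev := hrev
  mix := hmix

theorem agree_of_isClosed {E : Defn S} {P : Syn S} (h : IsClosed E P) (Γ : S.Var → Option T)
    (γ : S.Var → T) : Agree E Γ γ P := fun x hx => (h x hx).elim

theorem cConv_of_divergenceFree {E : Defn S} {P : Syn S} {Γ : S.Var → Option T} {γ : S.Var → T}
    {t : List (Event S T)} {q : Config S T} (hR : Regular E P) (hΓ : Agree E Γ γ P)
    (hd : ((P.inst Γ).lts E).DivergenceFree) (h : Path (CStep E) (P, γ) t q) :
    CConv E q.2 q.1 := by
  obtain ⟨Γ', h1, h2⟩ := exists_path_bStep (p := (P, γ)) hR hΓ h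
  exact (conv_of_divergenceFree hd h1).cConv h2

/-! ## Extension of behaviours -/

/-- An event whose images under sufficiently many functions are possible is possible. -/
theorem CConv.exists_cStep {E : Defn S} {P : Syn S} {σ : List (SLabel S)} {B n : ℕ}
    (hBn : B + 1 ≤ n) (hB : thresh E P (Fin n) ≤ (B : ℕ∞)) {φ : Fin n → Fin (B + 1)}
    (hφ : IsCollapsing B φ) {q : Config S (Fin n)} (hσ : Path (SStep E) P σ q.1)
    (hR : Regular E q.1) (hc : CConv E q.2 q.1) {e : Event S (Fin n)}
    (he : ∀ π : Equiv.Perm (Fin n), Behav E (q.1, (φ ∘ π) ∘ q.2) [e.map (φ ∘ π)] none) :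
    ∃ q', CStep E q e q' := by
  have hm : 1 ≤ B + 1 := Nat.le_add_left _ _
  -- The identity permutation is enough for the channel and the fields not of type `t`, which no
  -- collapse changes.
  obtain ⟨q₁, hq₁, -⟩ := Behav.cons_iff.1 (he 1)
  obtain ⟨tf, nf, k, hi⟩ := hc.exists_init hm hR ⟨q₁, hq₁⟩
  replace hi : Init E q.2 q.1 (.pre e.chan tf nf k) := hi
  have hw : NAdmissible nf e.nval := (hi.behav_comp hm hR (he 1)).1
  obtain ⟨ρ, R, h1, -, -, h2⟩ := hi.offers hw
  let ε : SEvent S := ⟨e.chan, tf, e.nval⟩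
  have hε : (σ ++ ρ) ++ [.vis ε] ∈ straces E P :=
    ⟨_, (hσ.append h1).append (.cons h2 (.nil _))⟩
  have hU : (e.tval '' {i | ∃ a, tf i = .out a}).encard ≤ B :=
    (SEvent.encard_image_outT_le (ε := ε) e.tval).trans ((outT_encard_le_thresh hε).trans hB)
  -- The permutation separates the values that `e` carries at the output positions, not those of the
  -- variables: it is for `e` that the position count gives a bound, and separating one side of the
  -- equation suffices.
  obtain ⟨π, hπ⟩ := exists_perm_lt (Nat.le_of_succ_le hBn) hU
  refine ⟨_, tf, nf, k, hi, hw, fun i x hx => ?_, rfl⟩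
  have ht := (hi.behav_comp hm hR (he π)).2.1 i x hx
  exact (hφ.injAt π (hπ _ ⟨i, ⟨_, hx⟩, rfl⟩) _ ht.symm).symm

/-- A failure whose images under sufficiently many functions are possible is possible. -/
theorem CConv.cFail {E : Defn S} {P : Syn S} {σ : List (SLabel S)} {B n : ℕ}
    (hBn : B + 1 ≤ n) (hB : thresh E P (Fin n) ≤ (B : ℕ∞)) {φ : Fin n → Fin (B + 1)}
    (hφ : IsCollapsing B φ) {q : Config S (Fin n)} (hσ : Path (SStep E) P σ q.1)
    (hlast : σ = [] ∨ ∃ l, σ.getLast? = some l ∧ l.IsVisible)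
    (hR : Regular E q.1) (hc : CConv E q.2 q.1) {X : Set (Event S (Fin n))}
    (hX : ∀ π : Equiv.Perm (Fin n),
      CFail E ((φ ∘ π) ∘ q.2) {y | ∀ e : Event S (Fin n), e.map (φ ∘ π) = y → e ∈ X} q.1) :
    CFail E q.2 X q.1 := by
  classical
  have : Nonempty (Fin n) := ⟨⟨0, by omega⟩⟩
  let A := available E P σ (fun x => some (q.2 x))
  let IsBad (ε : SEvent S) (v : TPos S ε.chan → Fin n) : Prop :=
    TMatch q.2 ε.tf v ∧ (⟨ε.chan, v, ε.nval⟩ : Event S (Fin n)) ∈ X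
  -- One event of `X` compatible with `ε`, if any exists; otherwise an arbitrary tuple, which is
  -- harmless because it too contributes at most `#?ᵗ(ε)` values.
  let bad (ε : SEvent S) : TPos S ε.chan → Fin n := Classical.epsilon (IsBad ε)
  let U₁ : Set (Fin n) := q.2 '' {x | ∃ ε ∈ A, ∃ i, ε.tf i = .out (.inl x)}
  let U₂ : Set (Fin n) := ⋃ ε ∈ A, bad ε '' {i | ∃ x, ε.tf i = .inp x}
  have hU₁ : U₁.encard ≤ threshOut E P σ (fun x => some (q.2 x)) := Set.encard_image_le _ _
  have hU₂ : U₂.encard ≤ threshIn E P σ (fun x => some (q.2 x)) := by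
    refine (encard_biUnion_le _ _).trans (iSup₂_mono fun F _ => Finset.sum_le_sum fun ε _ => ?_)
    exact SEvent.encard_image_inT_le _
  have hU : (U₁ ∪ U₂).encard ≤ B :=
    ((Set.encard_union_le _ _).trans (add_le_add hU₁ hU₂)).trans
      ((threshOut_add_threshIn_le_thresh ⟨_, hσ⟩ hlast _).trans hB)
  -- This one permutation is good for all available symbolic events simultaneously.
  obtain ⟨π, hπ⟩ := exists_perm_lt (Nat.le_of_succ_le hBn) hU
  refine CFail.of_comp (Nat.le_add_left _ _) hc hR (fun c tf nf k hi w hw => ?_) (hX π)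
  have hA : (⟨c, tf, w⟩ : SEvent S) ∈ A := by
    obtain ⟨ρ, R, h1, h2, h3, h4⟩ := hi.offers hw
    exact ⟨q.1, ρ, R, _, hσ, h1, h2, h3, h4⟩
  refine ⟨fun i x hx => hφ.injAt π (hπ _ (.inl ⟨x, ⟨_, hA, i, hx⟩, rfl⟩)), fun hbad => ?_⟩
  have hb : IsBad ⟨c, tf, w⟩ (bad ⟨c, tf, w⟩) := Classical.epsilon_spec hbad
  refine ⟨bad ⟨c, tf, w⟩, hb.1, hb.2, fun i x hx => hφ.injAt π (hπ _ (.inr ?_))⟩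
  simp only [U₂, Set.mem_iUnion]
  exact ⟨_, hA, i, ⟨x, hx⟩, rfl⟩

end CSP

/-! ### The extendibility theorem. -/

theorem theorem6p7 {S : CSP.Sig.{u}} (E : CSP.Defn S) (Spec : CSP.Syn S)
    (Impl : (n : ℕ) → CSP.LTS.{u, v} (Option (CSP.Event S (Fin n))))
    (hclosed : CSP.IsClosed E Spec)
    (hnorm : CSP.IsSeqNorm E Spec)
    (hrev : CSP.RevPosConjEqTF E Spec)
    (hdiv : ∀ m : ℕ, 1 ≤ m → (Spec.proc E (Fin m)).DivergenceFree)
    (hfin : ∀ m : ℕ, 1 ≤ m → (Spec.proc E (Fin m)).alphabet.Finite)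
    (hsym : CSP.TypeSym Impl)
    (hmix : CSP.NoMixedConstruct E Spec)
    (B n : ℕ) (hn : B + 1 ≤ n)
    (hB : CSP.thresh E Spec (Fin n) ≤ (B : ℕ∞))
    (φ : Fin n → Fin (B + 1)) (hφ : CSP.IsCollapsing B φ)
    (href : CSP.LTS.Refined (Spec.proc E (Fin (B + 1))) ((Impl n).rename (CSP.Event.map φ))) :
    CSP.LTS.Refined (Spec.proc E (Fin n)) (Impl n) := by
  open CSP in
  have hn1 : 1 ≤ n := by omega
  have hm : 1 ≤ B + 1 := by omega
  have hR : Regular E Spec := hnorm.regular hrev hmix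
  have : Nonempty (Fin n) := ⟨⟨0, hn1⟩⟩
  -- Any valuation will do, since the specification has no free variables.
  let γ : S.Var → Fin n := fun _ => ⟨0, hn1⟩
  have hag : Agree E (fun _ => none) γ Spec := agree_of_isClosed hclosed _ _
  have hcoll : ∀ π : Equiv.Perm (Fin n),
      (∀ t ∈ (Impl n).traces, Behav E (Spec, (φ ∘ π) ∘ γ) (t.map (Event.map (φ ∘ π))) none) ∧
      ∀ t X, (t, X) ∈ (Impl n).failures →
        Behav E (Spec, (φ ∘ π) ∘ γ) (t.map (Event.map (φ ∘ π)))
          (some {y | ∀ e : Event S (Fin n), e.map (φ ∘ π) = y → e ∈ X}) := fun π =>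
    ⟨fun t ht => (mem_traces_inst hR (agree_of_isClosed hclosed _ _)).1
        ((hsym.refined hn1 π φ href).1 t ht),
      fun t X hX => (mem_failures_inst hR (agree_of_isClosed hclosed _ _)).1
        ((hsym.refined hn1 π φ href).2 t X hX)⟩
  -- Induction from the right: the images of the longer trace, pushed along the path for its prefix,
  -- make the images of the last event possible at the configuration reached.
  have htr : ∀ t ∈ (Impl n).traces, ∃ q, Path (CStep E) (Spec, γ) t q := by
    intro t
    induction t using List.reverseRecOn with
    | nil => exact fun _ => ⟨_, .nil _⟩
    | append_singleton t e ih =>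
      intro ht
      obtain ⟨q, hq⟩ := ih (LTS.mem_traces_of_append ht)
      obtain ⟨σ, hσ, -⟩ := exists_symbolic_path hq
      obtain ⟨q', hq'⟩ := CConv.exists_cStep hn hB hφ hσ (Regular.path (p := (Spec, γ)) hR hq)
        (cConv_of_divergenceFree hR hag (hdiv n hn1) hq) (e := e) fun π =>
          Behav.of_path hm (φ ∘ π) hq hR (by simpa using (hcoll π).1 _ ht)
      exact ⟨q', hq.append (.cons hq' (.nil _))⟩
  refine ⟨fun t ht => ?_, ?_⟩
  · obtain ⟨q, hq⟩ := htr t ht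
    exact (mem_traces_inst hR hag).2 ⟨q, hq, fun Y hY => by cases hY⟩
  · rintro ⟨t, X⟩ hX
    obtain ⟨q, hq⟩ := htr t ⟨_, hX.choose_spec.1⟩
    obtain ⟨σ, hσ, hlast⟩ := exists_symbolic_path hq
    refine (mem_failures_inst hR hag).2 ⟨q, hq, fun Y hY => ?_⟩
    cases hY
    refine CConv.cFail hn hB hφ hσ hlast (Regular.path (p := (Spec, γ)) hR hq)
      (cConv_of_divergenceFree hR hag (hdiv n hn1) hq) fun π => ?_
    -- With nothing left after `t`, the remaining path is empty, so the collapsed refusal holds at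
    -- the image of `q` itself.
    obtain ⟨q', hq', hY⟩ := Behav.of_path hm (φ ∘ π) (s := []) hq hR
      (by simpa using (hcoll π).2 _ _ hX)
    cases hq'
    exact hY _ rfl
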